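/- Let $p$ be a prime. For a finitely generated group $H$ let $d(H)$ denote the minimal number of generators of $H$, and for any group $G$ let the (Prüfer) rank of $G$ be the supremum of $d(H)$ over all finitely generated subgroups $H$ of $G$. Put $P(G)=\gamma_2(G)G^p$ if $p>2$ and $P(G)=\gamma_2(G)G^4$ if $p=2$, where $\gamma_2(G)=[G,G]$ and $G^n$ is the subgroup generated by the $n$-th powers of elements of $G$ (so for abelian $G$, $P(G)=G^p$ or $P(G)=G^4$ respectively). Let $G$ be an abelian $p$-group (not necessarily finite) of finite rank $d$, and let $d'$ be the rank of $P(G)$. Then every $p$-subgroup $Q$ of $\mathrm{Aut}(G)$ can be generated by at most $dd'+\frac{d^2}{4}$ elements if $p>2$, and by at most $dd'+\frac{3d^2-d}{2}$ elements if $p=2$. In particular every such $Q$ is finitely generated and satisfies $d(Q)\le \frac{5d^2}{4}$ if $p>2$, and $d(Q)\le\frac{5d^2-d}{2}$ if $p=2$. -/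

import Mathlib

/-- The (Prüfer) rank `rk(G)` of a group `G`: the supremum, in `ℕ∞`, of the minimal numbers of
generators `d(H)` of the finitely generated subgroups `H` of `G`. -/
noncomputable def pruferRank (G : Type*) [Group G] : ℕ∞ :=
  ⨆ (H : Subgroup G) (h : Group.FG H), ((@Group.rank H _ h : ℕ) : ℕ∞)

/-- The subgroup `G ^ n` generated by the `n`-th powers of the elements of `G`. -/
def powSubgroup (n : ℕ) (G : Type*) [Group G] : Subgroup G :=
  Subgroup.closure (Set.range fun x : G => x ^ n)

/-- The subgroup `P(G)`: it is `γ₂(G) G ^ 4` if `p = 2`, and `γ₂(G) G ^ p` otherwise. -/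
def commPowSubgroup (p : ℕ) (G : Type*) [Group G] : Subgroup G :=
  commutator G ⊔ powSubgroup (if p = 2 then 4 else p) G

/-! ### Generating finite `p`-groups -/

section Generation

variable {p : ℕ} [hp : Fact p.Prime] {Q : Type*} [Group Q] [Finite Q]

/-! Write G additively. For large k the group p^k G is divisible by p, and then a p-group Q of
automorphisms acts faithfully on the finite group A = G[p^k] (`mulAutToEndKer_faithful`), which has
at most d generators. So Q is finite; let K_n be its subgroup acting trivially on A/p^n A.
Generators are collected layer by layer.

Modulo K_1, the action on the F_p-space A/pA is unitriangular of size n ≤ d. Give position (i, j)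
the height 2^j - 2^i: distinct positions have distinct heights, so orders are counted by leading
positions. Commutators produce (i, j) from (i, k) and (k, j), hence the positions not reached by
commutators form a triangle-free graph, and Mantel's theorem leaves at most n^2/4 generators
(`card_le_of_unitriangular`).

Take n₀ = 1 for odd p and n₀ = 2 for p = 2. On K_{n₀} the map 1 + f ↦ (1 + f)^p is governed by its
linear term p f, so its fibres are no larger than those of multiplication by p on d-tuples from
p^{n₀} A, at most p^{dd'}. As p-th powers lie in the Frattini subgroup, dd' generators suffice
(`IsPGroup.exists_closure_eq_top_of_congruence`).

For p = 2 the layer K_1/K_2 has order at most 2^{d^2} and costs d^2 further generators; ⌊d^2/4⌋ +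
d^2 ≤ (3d^2 - d)/2 closes the count. -/

theorem IsPGroup.normal_of_isCoatom (hQ : IsPGroup p Q) {M : Subgroup Q} (hM : IsCoatom M) :
    M.Normal := by
  have := hQ.isNilpotent
  exact Subgroup.NormalizerCondition.normal_of_coatom M Group.normalizerCondition_of_isNilpotent hM

theorem IsPGroup.index_of_isCoatom (hQ : IsPGroup p Q) {M : Subgroup Q} (hM : IsCoatom M) :
    M.index = p := by
  obtain ⟨N, hN, hMN⟩ : ∃ N : Subgroup Q, Nat.card N = Nat.card M * p ∧ M ≤ N := by
    obtain ⟨n, hn⟩ := IsPGroup.iff_card.1 hQ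
    obtain ⟨m, hm⟩ := IsPGroup.iff_card.1 (hQ.to_subgroup M)
    have hlt : m < n := by
      have h1 : Nat.card M < Nat.card Q := by
        refine lt_of_le_of_ne (Subgroup.card_le_card_group M) fun h ↦ hM.1 ?_
        exact Subgroup.eq_top_of_card_eq M h
      rw [hm, hn] at h1
      exact (Nat.pow_lt_pow_iff_right hp.1.one_lt).1 h1
    obtain ⟨N, hN, hMN⟩ := Sylow.exists_subgroup_card_pow_succ (G := Q) (p := p) (n := m)
      (by rw [hn]; exact pow_dvd_pow p hlt) hm
    exact ⟨N, by rw [hN, hm, pow_succ], hMN⟩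
  have hne : N ≠ M := by
    rintro rfl
    have h0 : 0 < Nat.card N := Nat.card_pos
    have := hp.1.one_lt
    nlinarith
  have htop : N = ⊤ := hM.2 N (lt_of_le_of_ne hMN hne.symm)
  subst htop
  have h0 : 0 < Nat.card M := Nat.card_pos
  have := M.card_mul_index
  rw [Subgroup.card_top] at hN
  rw [hN] at this
  exact Nat.eq_of_mul_eq_mul_left h0 this

theorem IsPGroup.pow_mem_frattini (hQ : IsPGroup p Q) (x : Q) : x ^ p ∈ frattini Q := by
  simp only [frattini, Order.radical, Subgroup.mem_iInf]
  intro M hM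
  have := hQ.normal_of_isCoatom hM
  have h := Subgroup.pow_index_mem M x
  rwa [hQ.index_of_isCoatom hM] at h

theorem IsPGroup.commutator_le_frattini (hQ : IsPGroup p Q) : commutator Q ≤ frattini Q := by
  simp only [frattini, Order.radical, le_iInf_iff]
  intro M hM
  have := hQ.normal_of_isCoatom hM
  have hc : Nat.card (Q ⧸ M) = p := hQ.index_of_isCoatom hM
  have := isCyclic_of_prime_card hc
  have hcomm : ∀ a b : Q ⧸ M, a * b = b * a := (IsCyclic.commGroup (α := Q ⧸ M)).mul_comm
  rw [commutator_def, Subgroup.commutator_le]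
  intro a _ b _
  rw [← QuotientGroup.eq_one_iff, commutatorElement_def]
  rw [QuotientGroup.mk_mul, QuotientGroup.mk_mul, QuotientGroup.mk_mul, hcomm (a : Q ⧸ M) b]
  simp

theorem IsPGroup.prime_mul_card_le_of_lt (hQ : IsPGroup p Q) {R T : Subgroup Q} (h : R < T) :
    p * Nat.card R ≤ Nat.card T := by
  obtain ⟨n, hn⟩ := IsPGroup.iff_card.1 (hQ.to_subgroup R)
  obtain ⟨m, hm⟩ := IsPGroup.iff_card.1 (hQ.to_subgroup T)
  have hlt : Nat.card R < Nat.card T := by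
    refine lt_of_le_of_ne (Subgroup.card_le_of_le h.le) fun he ↦ h.ne ?_
    exact Subgroup.eq_of_le_of_card_ge h.le he.ge
  rw [hn, hm] at *
  rw [← pow_succ']
  exact Nat.pow_le_pow_right hp.1.pos ((Nat.pow_lt_pow_iff_right hp.1.one_lt).1 hlt)

/-- Each generator adjoined outside the current subgroup multiplies its order by at least p, so at
most m are needed. -/
theorem IsPGroup.exists_closure_sup_eq (hQ : IsPGroup p Q) (m : ℕ) {R T : Subgroup Q} (hRT : R ≤ T)
    (h : Nat.card T ≤ p ^ m * Nat.card R) :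
    ∃ S : Finset Q, S.card ≤ m ∧ Subgroup.closure (S : Set Q) ⊔ R = T := by
  classical
  induction m generalizing R with
  | zero => exact ⟨∅, by simp, by simpa using Subgroup.eq_of_le_of_card_ge hRT (by simpa using h)⟩
  | succ m ih =>
    rcases hRT.eq_or_lt with rfl | hlt
    · exact ⟨∅, by simp, by simp⟩
    obtain ⟨x, hxT, hxR⟩ := SetLike.exists_of_lt hlt
    have hx : Subgroup.zpowers x ≤ T := by simpa using hxT
    have hlt' : R < R ⊔ Subgroup.zpowers x :=
      lt_of_le_of_ne le_sup_left fun he ↦ hxR (by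
        rw [he]; exact (le_sup_right : _ ≤ R ⊔ Subgroup.zpowers x) (Subgroup.mem_zpowers x))
    obtain ⟨S, hS, hST⟩ := ih (R := R ⊔ Subgroup.zpowers x) (sup_le hRT hx) (by
      calc _ ≤ _ := h
        _ = p ^ m * (p * Nat.card R) := by ring
        _ ≤ _ := Nat.mul_le_mul_left _ (hQ.prime_mul_card_le_of_lt hlt'))
    refine ⟨insert x S, (Finset.card_insert_le _ _).trans (by omega), ?_⟩
    rw [← hST, Finset.coe_insert, Set.insert_eq, Subgroup.closure_union,
      ← Subgroup.zpowers_eq_closure]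
    ac_rfl

theorem IsPGroup.exists_closure_eq_top (hQ : IsPGroup p Q) (m : ℕ) {R : Subgroup Q}
    (hR : R ≤ frattini Q) (h : Nat.card Q ≤ p ^ m * Nat.card R) :
    ∃ S : Finset Q, S.card ≤ m ∧ Subgroup.closure (S : Set Q) = ⊤ := by
  obtain ⟨S, hS, hST⟩ := hQ.exists_closure_sup_eq m (R := R) le_top (by simpa using h)
  exact ⟨S, hS, frattini_nongenerating (top_le_iff.1 (hST.ge.trans (sup_le_sup_left hR _)))⟩

/-- If the fibres of the `p`-th power map of a finite `p`-group have at most `p ^ m` elements,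
then the group can be generated by `m` elements. -/
theorem IsPGroup.exists_closure_eq_top_of_card_fiber_le (hQ : IsPGroup p Q) (m : ℕ)
    (h : ∀ z : Q, Nat.card {x : Q // x ^ p = z} ≤ p ^ m) :
    ∃ S : Finset Q, S.card ≤ m ∧ Subgroup.closure (S : Set Q) = ⊤ := by
  classical
  have := Fintype.ofFinite Q
  set R := Subgroup.closure (Set.range fun x : Q ↦ x ^ p)
  refine hQ.exists_closure_eq_top m (R := R) ((Subgroup.closure_le _).2 ?_) ?_
  · rintro _ ⟨x, rfl⟩
    exact hQ.pow_mem_frattini x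
  -- All p-th powers lie in R, so the fibre bound gives |Q| ≤ p^m |R|.
  have h1 := Finset.card_le_mul_card_image_of_maps_to (s := (Finset.univ : Finset Q))
    (t := Finset.univ.filter (· ∈ R)) (f := fun x ↦ x ^ p)
    (fun x _ ↦ Finset.mem_filter.2 ⟨Finset.mem_univ _, Subgroup.subset_closure ⟨x, rfl⟩⟩)
    (p ^ m) (fun z _ ↦ by
      have := h z
      rwa [Nat.card_eq_fintype_card, Fintype.card_subtype] at this)
  rw [Nat.card_eq_fintype_card, Nat.card_eq_fintype_card, Fintype.card_subtype]
  exact h1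

end Generation

/-! ### Unitriangular representations: leading positions and Mantel's theorem -/

section Unitriangular

open scoped commutatorElement

/-- The matrices all of whose non-zero entries are at positions `(i, j)` with
`2 ^ j - 2 ^ i ≥ s`. -/
def heightFiltration (n : ℕ) (R : Type*) [Ring R] (s : ℕ) :
    AddSubgroup (Matrix (Fin n) (Fin n) R) where
  carrier := {X | ∀ i j, X i j ≠ 0 → 2 ^ (i : ℕ) + s ≤ 2 ^ (j : ℕ)}
  zero_mem' := by simp
  add_mem' := by
    intro X Y hX hY i j h
    by_cases hx : X i j = 0
    · exact hY i j fun hy ↦ h (by simp [hx, hy])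
    · exact hX i j hx
  neg_mem' := by
    intro X hX i j h
    exact hX i j (by simpa using h)

/-- Heights telescope along a path: (2^k - 2^i) + (2^j - 2^k) = 2^j - 2^i. -/
theorem mul_mem_heightFiltration {n : ℕ} {R : Type*} [Ring R] {s t : ℕ}
    {X Y : Matrix (Fin n) (Fin n) R} (hX : X ∈ heightFiltration n R s)
    (hY : Y ∈ heightFiltration n R t) : X * Y ∈ heightFiltration n R (s + t) := by
  intro i j h
  rw [Matrix.mul_apply] at h
  obtain ⟨k, -, hk⟩ := Finset.exists_ne_zero_of_sum_ne_zero h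
  have h1 := hX i k (left_ne_zero_of_mul hk)
  have h2 := hY k j (right_ne_zero_of_mul hk)
  omega

theorem heightFiltration_anti {n : ℕ} {R : Type*} [Ring R] {s t : ℕ} (h : s ≤ t) :
    heightFiltration n R t ≤ heightFiltration n R s := by
  intro X hX i j hij
  have := hX i j hij
  omega

/-- Comparing divisibility by powers of 2 recovers i, then j. This is the reason for powers of two:
each layer of the filtration is a single matrix entry. -/
theorem two_pow_add_eq_unique {i j k l : ℕ} {s : ℕ} (hs : 0 < s) (h1 : 2 ^ i + s = 2 ^ j)
    (h2 : 2 ^ k + s = 2 ^ l) : i = k ∧ j = l := by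
  have hij : i < j := (Nat.pow_lt_pow_iff_right one_lt_two).1 (by omega)
  have hkl : k < l := (Nat.pow_lt_pow_iff_right one_lt_two).1 (by omega)
  have key : ∀ {i j k l : ℕ}, i < j → k < l → 2 ^ j + 2 ^ k = 2 ^ l + 2 ^ i → ¬ i < k := by
    intro i j k l hij hkl h hik
    have d1 : 2 ^ (i + 1) ∣ 2 ^ j := pow_dvd_pow 2 hij
    have d2 : 2 ^ (i + 1) ∣ 2 ^ k := pow_dvd_pow 2 hik
    have d3 : 2 ^ (i + 1) ∣ 2 ^ l := pow_dvd_pow 2 (by omega)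
    have d4 : 2 ^ (i + 1) ∣ 2 ^ i := (Nat.dvd_add_right d3).1 (h ▸ dvd_add d1 d2)
    have := (Nat.pow_dvd_pow_iff_le_right (by norm_num)).1 d4
    omega
  have hik : i = k := by
    rcases lt_trichotomy i k with h | h | h
    · exact (key hij hkl (by omega) h).elim
    · exact h
    · exact (key hkl hij (by omega) h).elim
  subst hik
  exact ⟨rfl, Nat.pow_right_injective le_rfl (by simp only; omega)⟩

variable {p : ℕ} [hp : Fact p.Prime] {Q : Type*} [Group Q] {n : ℕ}
  (ρ : Q →* Matrix (Fin n) (Fin n) (ZMod p))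

/-- The elements acting trivially modulo the step `s` of the height filtration. -/
def heightSubgroup (hρ : ∀ q, ρ q - 1 ∈ heightFiltration n (ZMod p) 1) (s : ℕ) : Subgroup Q where
  carrier := {q | ρ q - 1 ∈ heightFiltration n (ZMod p) s}
  one_mem' := by simp [zero_mem]
  mul_mem' := by
    intro a b ha hb
    have h : ρ (a * b) - 1 = (ρ a - 1) + (ρ b - 1) + (ρ a - 1) * (ρ b - 1) := by
      rw [map_mul]; noncomm_ring
    rw [Set.mem_ofPred_eq, h]
    exact add_mem (add_mem ha hb)
      (heightFiltration_anti (Nat.le_add_right s s) (mul_mem_heightFiltration ha hb))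
  inv_mem' := by
    intro a ha
    have h : ρ a⁻¹ - 1 = -((ρ a - 1) + (ρ a - 1) * (ρ a⁻¹ - 1)) := by
      have : ρ a * ρ a⁻¹ = 1 := by rw [← map_mul]; simp
      rw [mul_sub, sub_mul, this]; noncomm_ring
    rw [Set.mem_ofPred_eq, h]
    exact neg_mem (add_mem ha
      (heightFiltration_anti (Nat.le_add_right s 1) (mul_mem_heightFiltration ha (hρ _))))

open scoped Classical in
/-- The positions of the leading entries of the elements of a subgroup. -/
noncomputable def leadingPositions (K : Subgroup Q) : Finset (Fin n × Fin n) :=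
  Finset.univ.filter fun x ↦ ∃ s, 0 < s ∧ 2 ^ (x.1 : ℕ) + s = 2 ^ (x.2 : ℕ) ∧
    ∃ q ∈ K, ρ q - 1 ∈ heightFiltration n (ZMod p) s ∧ (ρ q - 1) x.1 x.2 ≠ 0

variable {ρ}

theorem mem_leadingPositions {K : Subgroup Q} {x : Fin n × Fin n} : x ∈ leadingPositions ρ K ↔
    ∃ s, 0 < s ∧ 2 ^ (x.1 : ℕ) + s = 2 ^ (x.2 : ℕ) ∧
    ∃ q ∈ K, ρ q - 1 ∈ heightFiltration n (ZMod p) s ∧ (ρ q - 1) x.1 x.2 ≠ 0 := by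
  simp only [leadingPositions, Finset.mem_filter, Finset.mem_univ, true_and]

theorem lt_of_mem_leadingPositions {K : Subgroup Q} {x : Fin n × Fin n}
    (h : x ∈ leadingPositions ρ K) : x.1 < x.2 := by
  obtain ⟨s, hs, h1, -⟩ := mem_leadingPositions.1 h
  exact Fin.lt_def.2 ((Nat.pow_lt_pow_iff_right one_lt_two).1 (by omega))

/-- The entry at a position of height `s`, as a homomorphism on the `s`-th height subgroup. -/
def leadingEntryHom (hρ : ∀ q, ρ q - 1 ∈ heightFiltration n (ZMod p) 1) {s : ℕ} (hs : 0 < s)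
    {i j : Fin n} (hij : 2 ^ (i : ℕ) + s = 2 ^ (j : ℕ)) :
    heightSubgroup ρ hρ s →* Multiplicative (ZMod p) where
  toFun q := Multiplicative.ofAdd ((ρ q - 1) i j)
  map_one' := by simp
  map_mul' := by
    intro a b
    rw [← ofAdd_add]
    congr 1
    have h : ρ (a * b) - 1 = (ρ a - 1) + (ρ b - 1) + (ρ a - 1) * (ρ b - 1) := by
      rw [map_mul]; noncomm_ring
    have h0 : ((ρ a - 1) * (ρ b - 1)) i j = 0 := by
      by_contra hne
      have := mul_mem_heightFiltration a.2 b.2 i j hne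
      omega
    rw [Subgroup.coe_mul, h, Matrix.add_apply, h0, Matrix.add_apply, add_zero]

theorem mem_heightSubgroup_succ_iff (hρ : ∀ q, ρ q - 1 ∈ heightFiltration n (ZMod p) 1) {s : ℕ}
    (hs : 0 < s) {i j : Fin n} (hij : 2 ^ (i : ℕ) + s = 2 ^ (j : ℕ)) {q : Q}
    (hq : q ∈ heightSubgroup ρ hρ s) :
    q ∈ heightSubgroup ρ hρ (s + 1) ↔ (ρ q - 1) i j = 0 := by
  constructor
  · intro h
    by_contra hne
    have := h i j hne
    omega
  · intro h k l hkl
    have h1 := hq k l hkl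
    rcases h1.eq_or_lt with h2 | h2
    · obtain ⟨h3, h4⟩ := two_pow_add_eq_unique hs hij h2
      obtain rfl := Fin.ext h3
      obtain rfl := Fin.ext h4
      exact (hkl h).elim
    · omega

/-- The entry at (i, j) is a homomorphism to a group of order p; it is non-zero on K, hence onto,
and its kernel is the next step. -/
theorem card_inf_heightSubgroup_eq [Finite Q]
    (hρ : ∀ q, ρ q - 1 ∈ heightFiltration n (ZMod p) 1) {s : ℕ}
    (hs : 0 < s) {i j : Fin n} (hij : 2 ^ (i : ℕ) + s = 2 ^ (j : ℕ)) (K : Subgroup Q)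
    (hK : (i, j) ∈ leadingPositions ρ K) :
    Nat.card (K ⊓ heightSubgroup ρ hρ s : Subgroup Q) =
      p * Nat.card (K ⊓ heightSubgroup ρ hρ (s + 1) : Subgroup Q) := by
  set H := K ⊓ heightSubgroup ρ hρ s
  set f : H →* Multiplicative (ZMod p) :=
    (leadingEntryHom hρ hs hij).comp (Subgroup.inclusion inf_le_right)
  have hle : K ⊓ heightSubgroup ρ hρ (s + 1) ≤ H :=
    inf_le_inf_left _ fun q hq ↦ heightFiltration_anti (Nat.le_succ s) hq
  have hker : f.ker = (K ⊓ heightSubgroup ρ hρ (s + 1)).subgroupOf H := by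
    ext q
    have hq : (q : Q) ∈ heightSubgroup ρ hρ s := q.2.2
    rw [MonoidHom.mem_ker, Subgroup.mem_subgroupOf, Subgroup.mem_inf,
      mem_heightSubgroup_succ_iff hρ hs hij hq]
    exact ⟨fun h ↦ ⟨q.2.1, (ofAdd_eq_one (A := ZMod p)).1 h⟩,
      fun h ↦ (ofAdd_eq_one (A := ZMod p)).2 h.2⟩
  have hrange : f.range = ⊤ := by
    have : Fact (Nat.card (Multiplicative (ZMod p))).Prime := by
      constructor
      rw [Nat.card_congr Multiplicative.toAdd, Nat.card_zmod]
      exact hp.1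
    refine (Subgroup.eq_bot_or_eq_top_of_prime_card f.range).resolve_left fun h ↦ ?_
    obtain ⟨t, ht, h1, q, hqK, hq, hne⟩ := mem_leadingPositions.1 hK
    obtain rfl : t = s := by simp only at h1; omega
    have : f ⟨q, hqK, hq⟩ ∈ f.range := ⟨_, rfl⟩
    rw [h, Subgroup.mem_bot] at this
    exact hne ((ofAdd_eq_one (A := ZMod p)).1 this)
  have h1 := f.ker.card_mul_index
  rw [Subgroup.index_ker, hrange, Subgroup.card_top, Nat.card_congr Multiplicative.toAdd,
    Nat.card_zmod, hker, Nat.card_congr (Subgroup.subgroupOfEquivOfLe hle).toEquiv] at h1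
  rw [← h1, mul_comm]

theorem card_eq_pow_leadingPositions [Finite Q]
    (hρ : ∀ q, ρ q - 1 ∈ heightFiltration n (ZMod p) 1) (K : Subgroup Q) :
    Nat.card K = p ^ (leadingPositions ρ K).card * Nat.card (K ⊓ ρ.ker : Subgroup Q) := by
  classical
  -- Every height is below 2^n, so at s = 2^n + 1 only the kernel of ρ remains; the induction climbs
  -- back down to s = 1.
  have key : ∀ m s, 0 < s → s + m = 2 ^ n + 1 →
      Nat.card (K ⊓ heightSubgroup ρ hρ s : Subgroup Q) =
      p ^ ((leadingPositions ρ K).filter fun x ↦ 2 ^ (x.1 : ℕ) + s ≤ 2 ^ (x.2 : ℕ)).card *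
        Nat.card (K ⊓ ρ.ker : Subgroup Q) := by
    intro m
    induction m with
    | zero =>
      intro s _ hs
      have hlt : ∀ i j : Fin n, ¬ 2 ^ (i : ℕ) + s ≤ 2 ^ (j : ℕ) := by
        intro i j h
        have : 2 ^ (j : ℕ) ≤ 2 ^ n := Nat.pow_le_pow_right (by norm_num) j.2.le
        have : 0 < 2 ^ (i : ℕ) := by positivity
        omega
      rw [Finset.filter_false_of_mem fun x _ ↦ hlt _ _, Finset.card_empty, pow_zero, one_mul]
      suffices h : heightSubgroup ρ hρ s = ρ.ker by rw [h]
      ext q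
      constructor
      · intro h
        rw [MonoidHom.mem_ker, ← sub_eq_zero]
        ext i j
        by_contra hne
        exact hlt i j (h i j hne)
      · intro h i j hne
        rw [MonoidHom.mem_ker.1 h] at hne
        simp at hne
    | succ m ih =>
      intro s hs hsm
      have ih' := ih (s + 1) (by omega) (by omega)
      by_cases hex : ∃ x ∈ leadingPositions ρ K, 2 ^ (x.1 : ℕ) + s = 2 ^ (x.2 : ℕ)
      · obtain ⟨⟨i, j⟩, hx, hij⟩ := hex
        rw [card_inf_heightSubgroup_eq hρ hs hij K hx, ih', ← mul_assoc, ← pow_succ']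
        congr 2
        have : (leadingPositions ρ K).filter (fun x ↦ 2 ^ (x.1 : ℕ) + s ≤ 2 ^ (x.2 : ℕ)) =
            insert (i, j) ((leadingPositions ρ K).filter
              fun x ↦ 2 ^ (x.1 : ℕ) + (s + 1) ≤ 2 ^ (x.2 : ℕ)) := by
          ext ⟨k, l⟩
          simp only [Finset.mem_filter, Finset.mem_insert, Prod.mk.injEq]
          constructor
          · rintro ⟨h1, h2⟩
            rcases h2.eq_or_lt with h2 | h2
            · obtain ⟨h3, h4⟩ := two_pow_add_eq_unique hs h2 hij
              exact Or.inl ⟨Fin.ext h3, Fin.ext h4⟩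
            · exact Or.inr ⟨h1, by omega⟩
          · rintro (⟨rfl, rfl⟩ | ⟨h1, h2⟩)
            · exact ⟨hx, hij.le⟩
            · exact ⟨h1, by omega⟩
        rw [this, Finset.card_insert_of_notMem]
        simp only [Finset.mem_filter, not_and]
        simp only at hij
        omega
      · have h1 : K ⊓ heightSubgroup ρ hρ s = K ⊓ heightSubgroup ρ hρ (s + 1) := by
          refine le_antisymm (fun q hq ↦ ⟨hq.1, fun i j hne ↦ ?_⟩)
            (inf_le_inf_left _ fun q hq ↦ heightFiltration_anti (Nat.le_succ s) hq)
          rcases (hq.2 i j hne).eq_or_lt with h | h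
          · exact (hex ⟨(i, j), mem_leadingPositions.2 ⟨s, hs, h, q, hq.1, hq.2, hne⟩, h⟩).elim
          · omega
        rw [h1, ih']
        congr 3
        ext x
        simp only [Finset.mem_filter, and_congr_right_iff]
        intro hx
        have : ¬ 2 ^ (x.1 : ℕ) + s = 2 ^ (x.2 : ℕ) := fun h ↦ hex ⟨x, hx, h⟩
        omega
  have h1 : heightSubgroup ρ hρ 1 = ⊤ := top_le_iff.1 fun q _ ↦ hρ q
  have := key (2 ^ n) 1 one_pos (by ring)
  rw [h1, inf_top_eq] at this
  rw [this, Finset.filter_true_of_mem]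
  intro x hx
  have := lt_of_mem_leadingPositions hx
  exact (Nat.pow_lt_pow_iff_right one_lt_two).2 this

/-- The leading part of the commutator is XY - YX, and uniqueness of heights leaves the single
product X i k * Y k j at (i, j). -/
theorem mem_leadingPositions_commutator (hρ : ∀ q, ρ q - 1 ∈ heightFiltration n (ZMod p) 1)
    {i k j : Fin n} (h1 : (i, k) ∈ leadingPositions ρ ⊤) (h2 : (k, j) ∈ leadingPositions ρ ⊤) :
    (i, j) ∈ leadingPositions ρ (commutator Q) := by
  have hik : (i : ℕ) < k := lt_of_mem_leadingPositions h1
  have hkj : (k : ℕ) < j := lt_of_mem_leadingPositions h2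
  obtain ⟨s, hs, e1, q, -, hq, hq0⟩ := mem_leadingPositions.1 h1
  obtain ⟨t, ht, e2, r, -, hr, hr0⟩ := mem_leadingPositions.1 h2
  simp only at e1 e2 hq0 hr0
  set X := ρ q - 1
  set Y := ρ r - 1
  -- [q, r] - 1 = (qr - rq)(rq)⁻¹, and (rq)⁻¹ is 1 up to terms of positive height.
  have hXY : ρ ⁅q, r⁆ - 1 = (X * Y - Y * X) + (X * Y - Y * X) * (ρ (r * q)⁻¹ - 1) := by
    have hu : ρ (r * q) * ρ (r * q)⁻¹ = 1 := by rw [← map_mul]; simp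
    have hc : ρ ⁅q, r⁆ = ρ (q * r) * ρ (r * q)⁻¹ := by
      rw [← map_mul, commutatorElement_def]; congr 1; group
    have hd : X * Y - Y * X = ρ (q * r) - ρ (r * q) := by
      simp only [X, Y, map_mul]; noncomm_ring
    rw [hd, hc, mul_sub, sub_mul, hu]; noncomm_ring
  have hm : X * Y - Y * X ∈ heightFiltration n (ZMod p) (s + t) :=
    sub_mem (mul_mem_heightFiltration hq hr)
      (add_comm t s ▸ mul_mem_heightFiltration hr hq)
  have hm' := mul_mem_heightFiltration hm (hρ (r * q)⁻¹)
  refine mem_leadingPositions.2 ⟨s + t, by omega, by simp only; omega, ⁅q, r⁆,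
    Subgroup.commutator_mem_commutator (Subgroup.mem_top _) (Subgroup.mem_top _), ?_, ?_⟩
  · rw [hXY]
    exact add_mem hm (heightFiltration_anti (Nat.le_succ _) hm')
  · have z1 : ((X * Y - Y * X) * (ρ (r * q)⁻¹ - 1)) i j = 0 := by
      by_contra hne
      have := hm' i j hne
      omega
    -- A non-zero term would give (i, l) the same height t as (k, j), forcing i = k.
    have z2 : (Y * X) i j = 0 := by
      rw [Matrix.mul_apply]
      refine Finset.sum_eq_zero fun l _ ↦ ?_
      by_contra hne
      have a1 := hr i l (left_ne_zero_of_mul hne)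
      have a2 := hq l j (right_ne_zero_of_mul hne)
      have := (two_pow_add_eq_unique ht (i := i) (j := l) (k := k) (l := j) (by omega) e2).1
      omega
    have z3 : (X * Y) i j = X i k * Y k j := by
      rw [Matrix.mul_apply]
      refine Finset.sum_eq_single k (fun l _ hl ↦ ?_) (by simp)
      by_contra hne
      have a1 := hq i l (left_ne_zero_of_mul hne)
      have a2 := hr l j (right_ne_zero_of_mul hne)
      exact hl (Fin.ext (two_pow_add_eq_unique hs (i := i) (k := i) (by omega) e1).2)
    simp only
    rw [hXY, Matrix.add_apply, z1, Matrix.sub_apply, z2, z3, sub_zero, add_zero]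
    exact mul_ne_zero hq0 hr0

/-- Mantel's theorem, for sets of ordered pairs without transitive triangles. -/
theorem four_mul_card_le_sq_of_no_triangle (E : Finset (Fin n × Fin n)) (hE : ∀ x ∈ E, x.1 < x.2)
    (h : ∀ i j k, (i, k) ∈ E → (k, j) ∈ E → (i, j) ∉ E) : 4 * E.card ≤ n ^ 2 := by
  classical
  let G : SimpleGraph (Fin n) := SimpleGraph.mk (fun i j ↦ (i, j) ∈ E ∨ (j, i) ∈ E)
    ⟨fun i j hij ↦ hij.symm⟩ ⟨fun i hi ↦ by
      rcases hi with hi | hi <;> exact lt_irrefl _ (hE _ hi)⟩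
  have hcf : G.CliqueFree 3 := by
    intro t ht
    rw [SimpleGraph.is3Clique_iff] at ht
    obtain ⟨a, b, c, hab, hac, hbc, -⟩ := ht
    have hE' : ∀ i j, (i, j) ∈ E → i < j := fun i j hij ↦ hE _ hij
    rcases hab with hab | hab <;> rcases hac with hac | hac <;> rcases hbc with hbc | hbc
    · exact h _ _ _ hab hbc hac
    · exact h _ _ _ hac hbc hab
    · have := hE' _ _ hab; have := hE' _ _ hac; have := hE' _ _ hbc; omega
    · exact h _ _ _ hac hab hbc
    · exact h _ _ _ hab hac hbc
    · have := hE' _ _ hab; have := hE' _ _ hac; have := hE' _ _ hbc; omega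
    · exact h _ _ _ hbc hac hab
    · exact h _ _ _ hbc hab hac
  have hcard : E.card = G.edgeFinset.card := by
    refine Finset.card_bij (fun x _ ↦ s(x.1, x.2)) ?_ ?_ ?_
    · rintro ⟨i, j⟩ hx
      simp only [SimpleGraph.mem_edgeFinset, SimpleGraph.mem_edgeSet]
      exact Or.inl hx
    · rintro ⟨i, j⟩ hx ⟨k, l⟩ hy hxy
      have := hE _ hx
      have := hE _ hy
      simp only [Sym2.eq_iff] at *
      rcases hxy with ⟨rfl, rfl⟩ | ⟨rfl, rfl⟩
      · rfl
      · omega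
    · intro e he
      induction e with
      | h i j =>
        simp only [SimpleGraph.mem_edgeFinset, SimpleGraph.mem_edgeSet] at he
        rcases he with he | he
        · exact ⟨(i, j), he, rfl⟩
        · exact ⟨(j, i), he, Sym2.eq_swap⟩
  have := SimpleGraph.CliqueFree.card_edgeFinset_le (r := 2) hcf
  simp only [Fintype.card_fin] at this
  rw [hcard]
  -- Turán's bound depends on the residue of n modulo 2.
  rcases Nat.mod_two_eq_zero_or_one n with h0 | h0 <;> rw [h0] at this <;> simp at this <;> omega

/-- A transitive triangle among the leading positions missing from R is impossible: its long side
already occurs in the commutator subgroup. Mantel's theorem bounds the missing positions. -/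
theorem card_le_of_unitriangular [Finite Q]
    (hρ : ∀ q, ρ q - 1 ∈ heightFiltration n (ZMod p) 1) :
    Nat.card Q ≤ p ^ (n ^ 2 / 4) * Nat.card (commutator Q ⊔ ρ.ker : Subgroup Q) := by
  classical
  set R := commutator Q ⊔ ρ.ker
  have h1 := card_eq_pow_leadingPositions hρ (⊤ : Subgroup Q)
  have h2 := card_eq_pow_leadingPositions hρ R
  rw [top_inf_eq, Subgroup.card_top] at h1
  rw [inf_eq_right.2 le_sup_right] at h2
  rw [h1, h2, ← mul_assoc, ← pow_add]
  refine Nat.mul_le_mul_right _ (Nat.pow_le_pow_right hp.1.pos ?_)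
  have h3 := four_mul_card_le_sq_of_no_triangle (leadingPositions ρ ⊤ \ leadingPositions ρ R)
    (fun x hx ↦ lt_of_mem_leadingPositions (Finset.mem_sdiff.1 hx).1) (by
      intro i j k hik hkj hij
      simp only [Finset.mem_sdiff] at *
      refine hij.2 ?_
      obtain ⟨s, hs, e, q, hq, hq'⟩ := mem_leadingPositions.1
        (mem_leadingPositions_commutator hρ hik.1 hkj.1)
      exact mem_leadingPositions.2 ⟨s, hs, e, q, (le_sup_left : _ ≤ R) hq, hq'⟩)
  have h4 := Finset.le_card_sdiff (leadingPositions ρ R) (leadingPositions ρ ⊤)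
  omega

end Unitriangular

/-! ### Linear representations of `p`-groups in characteristic `p` -/

section Triangularization

variable {p : ℕ} [hp : Fact p.Prime] {Q : Type*} [Group Q]
  {V : Type*} [AddCommGroup V] [Module (ZMod p) V] [Finite V]

/-- The order of V/W is divisible by p and 0 is fixed, so the p-group Q has a second fixed point
there; x lifts it. -/
theorem IsPGroup.exists_sub_mem_of_invariant (hQ : IsPGroup p Q)
    (σ : Q →* Module.End (ZMod p) V) (W : Submodule (ZMod p) V) (hW : W ≠ ⊤)
    (hinv : ∀ q, ∀ w ∈ W, σ q w ∈ W) : ∃ x ∉ W, ∀ q, σ q x - x ∈ W := by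
  let act : MulAction Q (V ⧸ W) :=
    { smul := fun q ↦ W.mapQ W (σ q) (hinv q)
      one_smul := by
        intro x
        induction x using Submodule.Quotient.induction_on with
        | H x => exact congrArg Submodule.Quotient.mk (by rw [map_one]; rfl)
      mul_smul := by
        intro a b x
        induction x using Submodule.Quotient.induction_on with
        | H x => exact congrArg Submodule.Quotient.mk (by rw [map_mul]; rfl) }
  have hsmul : ∀ (q : Q) (x : V), q • (Submodule.Quotient.mk x : V ⧸ W) =
      Submodule.Quotient.mk (σ q x) := fun q x ↦ rfl
  have : Nontrivial (V ⧸ W) := Submodule.Quotient.nontrivial_iff.2 hW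
  have : Finite (V ⧸ W) := Finite.of_surjective _ W.mkQ_surjective
  have hcard : p ∣ Nat.card (V ⧸ W) := by
    rw [Module.natCard_eq_pow_finrank (K := ZMod p), Nat.card_zmod]
    exact dvd_pow_self p Module.finrank_pos.ne'
  have h0 : (0 : V ⧸ W) ∈ MulAction.fixedPoints Q (V ⧸ W) := by
    intro q
    rw [← Submodule.Quotient.mk_zero, hsmul, map_zero]
  obtain ⟨b, hb, hne⟩ := hQ.exists_fixed_point_of_prime_dvd_card_of_fixed_point (V ⧸ W) hcard h0
  induction b using Submodule.Quotient.induction_on with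
  | H x =>
    refine ⟨x, fun hx ↦ hne ((Submodule.Quotient.mk_eq_zero W).2 hx).symm, fun q ↦ ?_⟩
    rw [← Submodule.Quotient.eq, ← hsmul]
    exact hb q

theorem IsPGroup.exists_flag (hQ : IsPGroup p Q) (σ : Q →* Module.End (ZMod p) V) (k : ℕ)
    (hk : k ≤ Module.finrank (ZMod p) V) :
    ∃ v : Fin k → V, LinearIndependent (ZMod p) v ∧
      ∀ q j, σ q (v j) - v j ∈ Submodule.span (ZMod p) (v '' {i | i < j}) := by
  induction k with
  | zero => exact ⟨Fin.elim0, linearIndependent_empty_type, fun _ j ↦ j.elim0⟩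
  | succ k ih =>
    obtain ⟨v, hv, hvσ⟩ := ih (by omega)
    set W := Submodule.span (ZMod p) (Set.range v)
    have hW : W ≠ ⊤ := by
      intro h
      have := finrank_range_le_card (R := ZMod p) v
      rw [Set.finrank] at this
      change Module.finrank (ZMod p) W ≤ _ at this
      rw [h, finrank_top, Fintype.card_fin] at this
      omega
    have hinv : ∀ q, ∀ w ∈ W, σ q w ∈ W := by
      intro q
      change W ≤ W.comap (σ q)
      rw [Submodule.span_le]
      rintro _ ⟨j, rfl⟩
      have h1 : σ q (v j) - v j ∈ W :=
        Submodule.span_mono (Set.image_subset_range _ _) (hvσ q j)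
      have h2 : v j ∈ W := Submodule.subset_span ⟨j, rfl⟩
      simpa using add_mem h1 h2
    obtain ⟨x, hx, hxσ⟩ := hQ.exists_sub_mem_of_invariant σ W hW hinv
    refine ⟨Fin.snoc v x, linearIndependent_finSnoc.2 ⟨hv, hx⟩, fun q j ↦ ?_⟩
    induction j using Fin.lastCases with
    | last =>
      rw [Fin.snoc_last]
      refine Submodule.span_mono ?_ (hxσ q)
      rintro _ ⟨i, rfl⟩
      exact ⟨i.castSucc, Fin.castSucc_lt_last i, by simp⟩
    | cast j =>
      rw [Fin.snoc_castSucc]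
      refine Submodule.span_mono ?_ (hvσ q j)
      rintro _ ⟨i, hi, rfl⟩
      exact ⟨i.castSucc, by simpa using hi, by simp⟩

theorem IsPGroup.exists_unitriangular (hQ : IsPGroup p Q) (σ : Q →* Module.End (ZMod p) V) {n : ℕ}
    (hn : Module.finrank (ZMod p) V = n) : ∃ ρ : Q →* Matrix (Fin n) (Fin n) (ZMod p),
      (∀ q, ρ q - 1 ∈ heightFiltration n (ZMod p) 1) ∧ ρ.ker = σ.ker := by
  obtain ⟨v, hv, hvσ⟩ := hQ.exists_flag σ n hn.ge
  let b := basisOfLinearIndependentOfCardEqFinrank' v hv (by simp [hn])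
  have hb : ⇑b = v := coe_basisOfLinearIndependentOfCardEqFinrank' v hv (by simp [hn])
  let e : Module.End (ZMod p) V ≃ₐ[ZMod p] Matrix (Fin n) (Fin n) (ZMod p) :=
    LinearMap.toMatrixAlgEquiv b
  have he : ∀ f i j, e f i j = b.repr (f (b j)) i := fun f i j ↦
    LinearMap.toMatrixAlgEquiv_apply b f i j
  clear_value e
  refine ⟨e.toRingEquiv.toMonoidHom.comp σ, fun q i j hij ↦ ?_, ?_⟩
  · have h1 : (e (σ q) - 1) i j = b.repr (σ q (b j) - b j) i := by
      rw [← map_one e, ← map_sub, he]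
      rfl
    have h0 : (e (σ q) - 1) i j ≠ 0 := hij
    rw [h1] at h0
    have h2 := hvσ q j
    rw [← hb, b.mem_span_image] at h2
    have h3 : i < j := h2 (Finsupp.mem_support_iff.2 h0)
    exact (Nat.pow_lt_pow_iff_right one_lt_two).2 h3
  · ext q
    rw [MonoidHom.mem_ker, MonoidHom.mem_ker]
    exact map_eq_one_iff e e.injective

/-- A finite `p`-group with a representation on an `n`-dimensional space over `ZMod p` is generated
by at most `n ^ 2 / 4` elements together with the kernel of the representation. -/
theorem IsPGroup.exists_closure_sup_ker_eq_top [Finite Q] (hQ : IsPGroup p Q)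
    (σ : Q →* Module.End (ZMod p) V) :
    ∃ S : Finset Q, S.card ≤ Module.finrank (ZMod p) V ^ 2 / 4 ∧
      Subgroup.closure (S : Set Q) ⊔ σ.ker = ⊤ := by
  generalize hn : Module.finrank (ZMod p) V = n
  obtain ⟨ρ, hρ, hker⟩ := hQ.exists_unitriangular σ hn
  have hcard := card_le_of_unitriangular hρ
  rw [hker, ← Subgroup.card_top (G := Q)] at hcard
  obtain ⟨S, hS, hST⟩ := hQ.exists_closure_sup_eq (n ^ 2 / 4) le_top hcard
  -- The commutator part of the subgroup lies in the Frattini subgroup and can be dropped.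
  refine ⟨S, hS, frattini_nongenerating (top_le_iff.1 ?_)⟩
  rw [← hST]
  exact sup_le (le_sup_left.trans le_sup_left)
    (sup_le (hQ.commutator_le_frattini.trans le_sup_right) (le_sup_right.trans le_sup_left))

end Triangularization

/-! ### Power maps on congruence subgroups -/

section Congruence

/-- The subgroup `p ^ n A` of an additive commutative group `A`. -/
def primePowMultiples (p : ℕ) (A : Type*) [AddCommGroup A] (n : ℕ) : AddSubgroup A :=
  (nsmulAddMonoidHom (α := A) (p ^ n)).range

/-- The subgroup of the elements of `p ^ n A` of order dividing `p`. -/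
def primePowSocle (p : ℕ) (A : Type*) [AddCommGroup A] (n : ℕ) : AddSubgroup A :=
  primePowMultiples p A n ⊓ (nsmulAddMonoidHom (α := A) p).ker

variable {p : ℕ} {A : Type*} [AddCommGroup A]

theorem mem_primePowMultiples {n : ℕ} {a : A} :
    a ∈ primePowMultiples p A n ↔ ∃ b, p ^ n • b = a := Iff.rfl

theorem mem_primePowSocle {n : ℕ} {a : A} :
    a ∈ primePowSocle p A n ↔ a ∈ primePowMultiples p A n ∧ p • a = 0 := Iff.rfl

theorem primePowMultiples_anti {m n : ℕ} (h : m ≤ n) :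
    primePowMultiples p A n ≤ primePowMultiples p A m := by
  rintro _ ⟨b, rfl⟩
  refine ⟨p ^ (n - m) • b, ?_⟩
  simp only [nsmulAddMonoidHom_apply]
  rw [← mul_smul, ← pow_add, Nat.add_sub_cancel' h]

theorem nsmul_mem_primePowMultiples {n : ℕ} {a : A} (h : a ∈ primePowMultiples p A n) :
    p • a ∈ primePowMultiples p A (n + 1) := by
  obtain ⟨b, rfl⟩ := h
  refine ⟨b, ?_⟩
  simp only [nsmulAddMonoidHom_apply]
  rw [← mul_smul, ← pow_succ']

theorem primePowMultiples_eq_bot {N n : ℕ} (hN : ∀ a : A, p ^ N • a = 0) (h : N ≤ n) :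
    primePowMultiples p A n = ⊥ := by
  rw [eq_bot_iff]
  intro a ha
  obtain ⟨b, rfl⟩ := primePowMultiples_anti h ha
  exact hN b

/-- Reduction modulo p^(n+1) A, restricted to this socle, has the next socle as kernel. -/
theorem card_primePowSocle_eq [Finite A] (n : ℕ) :
    Nat.card (primePowSocle p A n) = Nat.card (primePowSocle p A (n + 1)) *
      Nat.card ((primePowSocle p A n).map
        (QuotientAddGroup.mk' (primePowMultiples p A (n + 1)))) := by
  rw [← AddSubgroup.relIndex_ker, QuotientAddGroup.ker_mk', AddSubgroup.relIndex,
    ← AddSubgroup.card_mul_index ((primePowMultiples p A (n + 1)).addSubgroupOf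
      (primePowSocle p A n))]
  congr 1
  have h : (primePowMultiples p A (n + 1)).addSubgroupOf (primePowSocle p A n) =
      (primePowSocle p A (n + 1)).addSubgroupOf (primePowSocle p A n) := by
    ext a
    rw [AddSubgroup.mem_addSubgroupOf, AddSubgroup.mem_addSubgroupOf, mem_primePowSocle]
    exact ⟨fun h ↦ ⟨h, a.2.2⟩, fun h ↦ h.1⟩
  rw [h]
  exact Nat.card_congr (AddSubgroup.addSubgroupOfEquivOfLe
    (inf_le_inf_right _ (primePowMultiples_anti n.le_succ))).toEquiv

/-- A subset of a finite abelian `p`-group such that differences in `p ^ n A` are mapped into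
`p ^ (n + 2) A` by multiplication by `p` is small. -/
theorem card_le_card_primePowSocle [Finite A] {N : ℕ} (hN : ∀ a : A, p ^ N • a = 0) {n₀ : ℕ}
    (F : Finset A) (hF : ∀ a ∈ F, ∀ b ∈ F, a - b ∈ primePowMultiples p A n₀)
    (h : ∀ n ≥ n₀, ∀ a ∈ F, ∀ b ∈ F, a - b ∈ primePowMultiples p A n →
      p • (a - b) ∈ primePowMultiples p A (n + 2)) :
    F.card ≤ Nat.card (primePowSocle p A n₀) := by
  classical
  -- Downward induction on n, from p^n A = 0 where F' has at most one point: split F' into classes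
  -- modulo p^(n+1) A, bound each class by the next socle, and count the classes.
  have key : ∀ m n, n₀ ≤ n → N ≤ n + m → ∀ F' ⊆ F,
      (∀ a ∈ F', ∀ b ∈ F', a - b ∈ primePowMultiples p A n) →
      F'.card ≤ Nat.card (primePowSocle p A n) := by
    intro m
    induction m with
    | zero =>
      intro n _ hn F' _ hF'
      refine (Finset.card_le_one.2 fun a ha b hb ↦ ?_).trans Nat.card_pos
      have := hF' a ha b hb
      rw [primePowMultiples_eq_bot hN (n := n) hn, AddSubgroup.mem_bot] at this
      exact sub_eq_zero.1 this
    | succ m ih =>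
      intro n hn hnm F' hF'F hF'
      rcases F'.eq_empty_or_nonempty with rfl | ⟨x₀, hx₀⟩
      · simp
      set π := QuotientAddGroup.mk' (primePowMultiples p A (n + 1))
      set I := (primePowSocle p A n).map π
      have hI : (I : Set (A ⧸ primePowMultiples p A (n + 1))).Finite := Set.toFinite _
      have h1 := Finset.card_le_mul_card_image_of_maps_to (s := F')
        (t := hI.toFinset.image (π x₀ + ·)) (f := π) (fun x hx ↦ ?_)
        (Nat.card (primePowSocle p A (n + 1))) (fun c _ ↦ ?_)
      · rw [card_primePowSocle_eq]
        refine h1.trans (Nat.mul_le_mul_left _ (Finset.card_image_le.trans ?_))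
        rw [← Nat.card_eq_card_finite_toFinset hI]
        rfl
      · obtain ⟨y, hy⟩ := hF' x (by simpa using hx) x₀ hx₀
        obtain ⟨z, hz⟩ := h n hn x (hF'F (by simpa using hx)) x₀ (hF'F hx₀) ⟨y, hy⟩
        simp only [nsmulAddMonoidHom_apply] at hy hz
        -- Since p (x - x₀) = p^(n+2) z, subtracting p^(n+1) z gives a socle element in the same
        -- class. Thus the classes lie in one translate of I.
        refine Finset.mem_image.2 ⟨π (x - x₀), hI.mem_toFinset.2
          ⟨x - x₀ - p ^ (n + 1) • z, mem_primePowSocle.2 ⟨?_, ?_⟩, ?_⟩, by simp⟩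
        · exact sub_mem ⟨y, hy⟩ (primePowMultiples_anti n.le_succ ⟨z, rfl⟩)
        · rw [smul_sub, ← hz, ← mul_smul, ← pow_succ', sub_self]
        · rw [map_sub, sub_eq_self]
          exact (QuotientAddGroup.eq_zero_iff _).2 ⟨z, rfl⟩
      · refine ih (n + 1) (by omega) (by omega) _ ((Finset.filter_subset _ _).trans hF'F)
          fun a ha b hb ↦ ?_
        rw [Finset.mem_filter] at ha hb
        rw [← QuotientAddGroup.eq_zero_iff]
        change π (a - b) = 0
        rw [map_sub, ha.2, hb.2, sub_self]
  exact key N n₀ le_rfl (by omega) F subset_rfl hF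

/-- The endomorphisms of `A` with image in `p ^ n A`. -/
def congruenceIdeal (p : ℕ) (A : Type*) [AddCommGroup A] (n : ℕ) :
    AddSubgroup (AddMonoid.End A) where
  carrier := {f | ∀ a, f a ∈ primePowMultiples p A n}
  zero_mem' := fun _ ↦ zero_mem _
  add_mem' := fun hf hg a ↦ add_mem (hf a) (hg a)
  neg_mem' := fun hf a ↦ neg_mem (hf a)

theorem congruenceIdeal_anti {m n : ℕ} (h : m ≤ n) :
    congruenceIdeal p A n ≤ congruenceIdeal p A m :=
  fun _ hf a ↦ primePowMultiples_anti h (hf a)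

theorem mul_mem_congruenceIdeal {m n : ℕ} {f g : AddMonoid.End A}
    (hf : f ∈ congruenceIdeal p A m) (hg : g ∈ congruenceIdeal p A n) :
    f * g ∈ congruenceIdeal p A (n + m) := by
  intro a
  obtain ⟨b, hb⟩ := hg a
  obtain ⟨c, hc⟩ := hf b
  refine ⟨c, ?_⟩
  change _ = f (g a)
  rw [← hb]
  simp only [nsmulAddMonoidHom_apply] at *
  rw [map_nsmul, ← hc, ← mul_smul, ← pow_add]

theorem nsmul_mem_congruenceIdeal {n : ℕ} {f : AddMonoid.End A}
    (hf : f ∈ congruenceIdeal p A n) : p • f ∈ congruenceIdeal p A (n + 1) :=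
  fun a ↦ nsmul_mem_primePowMultiples (hf a)

theorem pow_mem_congruenceIdeal {n : ℕ} {f : AddMonoid.End A}
    (hf : f ∈ congruenceIdeal p A n) (k : ℕ) : f ^ k ∈ congruenceIdeal p A (k * n) := by
  induction k with
  | zero => exact fun a ↦ ⟨a, by simp⟩
  | succ k ih =>
    rw [pow_succ]
    exact congruenceIdeal_anti (by ring_nf; rfl) (mul_mem_congruenceIdeal ih hf)

/-- Telescoping without commutativity: each term contains f - g once and k further factors, each
contributing n₀. -/
theorem pow_sub_pow_mem_congruenceIdeal {n₀ n : ℕ} {f g : AddMonoid.End A}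
    (hf : f ∈ congruenceIdeal p A n₀) (hg : g ∈ congruenceIdeal p A n₀)
    (hfg : f - g ∈ congruenceIdeal p A n) (k : ℕ) :
    f ^ (k + 1) - g ^ (k + 1) ∈ congruenceIdeal p A (n + k * n₀) := by
  induction k with
  | zero => simpa using hfg
  | succ k ih =>
    have h : f ^ (k + 1 + 1) - g ^ (k + 1 + 1) =
        f * (f ^ (k + 1) - g ^ (k + 1)) + (f - g) * g ^ (k + 1) := by
      rw [pow_succ' f, pow_succ' g]; noncomm_ring
    rw [h]
    refine add_mem (congruenceIdeal_anti (by ring_nf; rfl) (mul_mem_congruenceIdeal hf ih))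
      (congruenceIdeal_anti (by ring_nf; rfl)
        (mul_mem_congruenceIdeal hfg (pow_mem_congruenceIdeal hg (k + 1))))

/-- Only binomial terms of degree m ≥ 2 remain. For m < p the coefficient gives one factor p and the
extra power at least another; for m = p the gain is (p - 1) n₀, which is why p = 2 needs n₀ = 2. -/
theorem one_add_pow_sub_mem_congruenceIdeal (hp : p.Prime) {n₀ n : ℕ} (hn₀ : 0 < n₀)
    (hpn : 2 ≤ (p - 1) * n₀) {f g : AddMonoid.End A}
    (hf : f ∈ congruenceIdeal p A n₀) (hg : g ∈ congruenceIdeal p A n₀)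
    (hfg : f - g ∈ congruenceIdeal p A n) :
    (f + 1) ^ p - (g + 1) ^ p - p • (f - g) ∈ congruenceIdeal p A (n + 2) := by
  obtain ⟨k, rfl⟩ : ∃ k, p = k + 2 := ⟨p - 2, by have := hp.two_le; omega⟩
  set p := k + 2
  have hexp : ∀ f : AddMonoid.End A, (f + 1) ^ p =
      ∑ m ∈ Finset.range (k + 1), (p.choose (m + 2)) • f ^ (m + 2) + p • f + 1 := by
    intro f
    rw [(Commute.one_right f).add_pow, Finset.sum_range_succ', Finset.sum_range_succ']
    simp [nsmul_eq_mul, Nat.cast_comm]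
  have h : (f + 1) ^ p - (g + 1) ^ p - p • (f - g) =
      ∑ m ∈ Finset.range (k + 1), (p.choose (m + 2)) • (f ^ (m + 2) - g ^ (m + 2)) := by
    rw [hexp f, hexp g]
    simp only [nsmul_eq_mul, mul_sub, Finset.sum_sub_distrib]
    abel
  rw [h]
  refine sum_mem fun m hm ↦ ?_
  rw [Finset.mem_range] at hm
  have hd := pow_sub_pow_mem_congruenceIdeal hf hg hfg (m + 1)
  rcases Nat.lt_or_ge (m + 2) p with hlt | hge
  · obtain ⟨c, hc⟩ := hp.dvd_choose_self (by omega : m + 2 ≠ 0) hlt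
    rw [hc, mul_comm, mul_smul]
    refine nsmul_mem (congruenceIdeal_anti ?_ (nsmul_mem_congruenceIdeal hd)) c
    nlinarith
  · refine nsmul_mem (congruenceIdeal_anti ?_ hd) _
    have : m + 1 = p - 1 := by omega
    rw [this]
    omega

variable [Fact p.Prime] {Q : Type*} [Group Q] [Finite Q]

/-- A `p`-group acting trivially on `A / p ^ n₀ A` is generated by `d * d'` elements, where `d` is
the number of generators of `A` and `p ^ d'` is the order of the socle of `p ^ n₀ A`. -/
theorem IsPGroup.exists_closure_eq_top_of_congruence (hQ : IsPGroup p Q) [Finite A] {N : ℕ}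
    (hN : ∀ a : A, p ^ N • a = 0) {n₀ : ℕ} (hn₀ : 0 < n₀) (hpn : 2 ≤ (p - 1) * n₀)
    (ρ : Q →* AddMonoid.End A) (hρ : Function.Injective ρ)
    (hρ' : ∀ q, ρ q - 1 ∈ congruenceIdeal p A n₀) {d d' : ℕ} (T : Finset A) (hT : T.card ≤ d)
    (hTA : AddSubgroup.closure (T : Set A) = ⊤)
    (hd' : Nat.card (primePowSocle p A n₀) ≤ p ^ d') :
    ∃ S : Finset Q, S.card ≤ d * d' ∧ Subgroup.closure (S : Set Q) = ⊤ := by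
  classical
  have hp : p.Prime := Fact.out
  refine hQ.exists_closure_eq_top_of_card_fiber_le (d * d') fun z ↦ ?_
  -- An element of Q is determined by its values on T, so the fibre over z embeds in T → A, where
  -- the socle bound applies.
  let ev : Q → T → A := fun q t ↦ ρ q t
  have hev : Function.Injective ev := fun q r h ↦ hρ <|
    AddMonoidHom.eq_of_eqOn_dense hTA fun t ht ↦ congrFun h ⟨t, ht⟩
  have hmem : ∀ q r n, ev q - ev r ∈ primePowMultiples p (T → A) n →
      ρ q - ρ r ∈ congruenceIdeal p A n := by
    rintro q r n ⟨y, hy⟩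
    have hle : AddSubgroup.closure (T : Set A) ≤
        (primePowMultiples p A n).comap (ρ q - ρ r : A →+ A) :=
      (AddSubgroup.closure_le _).2 fun t ht ↦ ⟨y ⟨t, ht⟩, congrFun hy ⟨t, ht⟩⟩
    exact fun a ↦ hle (hTA ▸ AddSubgroup.mem_top a)
  have hmem' : ∀ (f : AddMonoid.End A) n, f ∈ congruenceIdeal p A n →
      (fun t : T ↦ f t) ∈ primePowMultiples p (T → A) n := by
    intro f n hf
    choose y hy using fun t : T ↦ hf t
    exact ⟨y, funext hy⟩
  have : Fintype Q := Fintype.ofFinite Q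
  have hcard := card_le_card_primePowSocle (p := p) (A := T → A) (N := N) (n₀ := n₀)
    (fun a ↦ funext fun t ↦ hN (a t)) ((Finset.univ.filter fun x : Q ↦ x ^ p = z).image ev)
    (by
      intro a ha b hb
      obtain ⟨q, -, rfl⟩ := Finset.mem_image.1 ha
      obtain ⟨r, -, rfl⟩ := Finset.mem_image.1 hb
      have := hmem' _ _ (sub_mem (hρ' q) (hρ' r))
      rw [sub_sub_sub_cancel_right] at this
      exact this)
    (by
      intro n _ a ha b hb hab
      obtain ⟨q, hq, rfl⟩ := Finset.mem_image.1 ha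
      obtain ⟨r, hr, rfl⟩ := Finset.mem_image.1 hb
      rw [Finset.mem_filter] at hq hr
      -- Equal p-th powers cancel, leaving p times the difference two steps deeper.
      have h1 := one_add_pow_sub_mem_congruenceIdeal hp hn₀ hpn (hρ' q) (hρ' r) (n := n)
        (by rw [sub_sub_sub_cancel_right]; exact hmem q r n hab)
      rw [sub_add_cancel, sub_add_cancel, ← map_pow, ← map_pow, hq.2, hr.2, sub_self, zero_sub,
        neg_mem_iff, sub_sub_sub_cancel_right] at h1
      exact hmem' _ _ h1)
  rw [Finset.card_image_of_injective _ hev] at hcard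
  rw [Nat.card_eq_fintype_card, Fintype.card_subtype]
  refine hcard.trans ?_
  let toSocle : primePowSocle p (T → A) n₀ → T → primePowSocle p A n₀ := fun x t ↦
    ⟨x.1 t, by
      obtain ⟨⟨y, hy⟩, hx⟩ := x.2
      exact ⟨⟨y t, congrFun hy t⟩, congrFun hx t⟩⟩
  have hinj : Function.Injective toSocle := fun x y h ↦ Subtype.ext <| funext fun t ↦
    congrArg Subtype.val (congrFun h t)
  refine (Nat.card_le_card_of_injective _ hinj).trans ?_
  rw [Nat.card_fun, Nat.card_eq_fintype_card (α := T), Fintype.card_coe]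
  calc _ ≤ (p ^ d') ^ T.card := Nat.pow_le_pow_left hd' _
    _ = p ^ (d' * T.card) := by rw [pow_mul]
    _ ≤ _ := Nat.pow_le_pow_right hp.pos (by rw [mul_comm]; exact Nat.mul_le_mul_right _ hT)

end Congruence

/-! ### `p`-groups of automorphisms of finite abelian `p`-groups -/

section FiniteCase

variable {p : ℕ} {A : Type*} [AddCommGroup A] {Q : Type*} [Group Q]

/-- The elements of `Q` acting trivially on `A / p ^ n A`. -/
def congruenceKernel (p : ℕ) (ρ : Q →* AddMonoid.End A) (n : ℕ) : Subgroup Q where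
  carrier := {q | ρ q - 1 ∈ congruenceIdeal p A n}
  one_mem' := by simp [zero_mem]
  mul_mem' := by
    intro a b ha hb
    have h : ρ (a * b) - 1 = (ρ a - 1) + (ρ b - 1) + (ρ a - 1) * (ρ b - 1) := by
      rw [map_mul]; noncomm_ring
    rw [Set.mem_ofPred_eq, h]
    exact add_mem (add_mem ha hb)
      (congruenceIdeal_anti (Nat.le_add_right n n) (mul_mem_congruenceIdeal ha hb))
  inv_mem' := by
    intro a ha
    have h : ρ a⁻¹ - 1 = -((ρ a - 1) + (ρ a - 1) * (ρ a⁻¹ - 1)) := by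
      have : ρ a * ρ a⁻¹ = 1 := by rw [← map_mul]; simp
      rw [mul_sub, sub_mul, this]; noncomm_ring
    rw [Set.mem_ofPred_eq, h]
    have h0 : ρ a⁻¹ - 1 ∈ congruenceIdeal p A 0 := fun x ↦ ⟨(ρ a⁻¹ - 1) x, by simp⟩
    exact neg_mem (add_mem ha (congruenceIdeal_anti (Nat.le_add_left n 0)
      (mul_mem_congruenceIdeal ha h0)))

theorem mem_congruenceKernel {ρ : Q →* AddMonoid.End A} {n : ℕ} {q : Q} :
    q ∈ congruenceKernel p ρ n ↔ ρ q - 1 ∈ congruenceIdeal p A n := Iff.rfl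

theorem mem_congruenceIdeal_of_closure {T : Set A} (hT : AddSubgroup.closure T = ⊤) {n : ℕ}
    {f : AddMonoid.End A} (h : ∀ t ∈ T, f t ∈ primePowMultiples p A n) :
    f ∈ congruenceIdeal p A n := by
  have hle : AddSubgroup.closure T ≤ (primePowMultiples p A n).comap (f : A →+ A) :=
    (AddSubgroup.closure_le _).2 h
  exact fun a ↦ hle (hT ▸ AddSubgroup.mem_top a)

theorem nsmul_quotient_primePowMultiples (x : A ⧸ primePowMultiples p A 1) : p • x = 0 := by
  induction x using QuotientAddGroup.induction_on with
  | H a => exact (QuotientAddGroup.eq_zero_iff (p • a)).2 ⟨a, by simp⟩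

noncomputable instance zmodModuleQuotient :
    Module (ZMod p) (A ⧸ primePowMultiples p A 1) :=
  AddCommGroup.zmodModule nsmul_quotient_primePowMultiples

theorem finrank_le_card_of_closure_eq_top [Fact p.Prime] {V : Type*} [AddCommGroup V]
    [Module (ZMod p) V] [Finite V] (π : A →+ V) (hπ : Function.Surjective π) (T : Finset A)
    (hTA : AddSubgroup.closure (T : Set A) = ⊤) : Module.finrank (ZMod p) V ≤ T.card := by
  classical
  have hspan : Submodule.span (ZMod p) ((T.image π : Finset V) : Set V) = ⊤ := by
    rw [eq_top_iff]
    intro x _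
    obtain ⟨a, rfl⟩ := hπ x
    have hle : AddSubgroup.closure (T : Set A) ≤
        (Submodule.span (ZMod p) ((T.image π : Finset V) : Set V)).toAddSubgroup.comap π :=
      (AddSubgroup.closure_le _).2 fun t ht ↦
        Submodule.subset_span (Finset.mem_coe.2 (Finset.mem_image_of_mem _ ht))
    exact hle (hTA ▸ AddSubgroup.mem_top a)
  have h1 := finrank_span_finset_le_card (R := ZMod p) (T.image π)
  rw [Set.finrank, hspan, finrank_top] at h1
  exact h1.trans Finset.card_image_le

theorem finrank_quotient_primePowMultiples_le [Fact p.Prime] [Finite A] {d : ℕ} (T : Finset A)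
    (hT : T.card ≤ d) (hTA : AddSubgroup.closure (T : Set A) = ⊤) :
    Module.finrank (ZMod p) (A ⧸ primePowMultiples p A 1) ≤ d :=
  (finrank_le_card_of_closure_eq_top (QuotientAddGroup.mk' (primePowMultiples p A 1))
    (QuotientAddGroup.mk'_surjective _) T hTA).trans hT

theorem index_primePowMultiples_le [Fact p.Prime] [Finite A] {d : ℕ} (T : Finset A)
    (hT : T.card ≤ d) (hTA : AddSubgroup.closure (T : Set A) = ⊤) :
    (primePowMultiples p A 1).index ≤ p ^ d := by
  have hp : p.Prime := Fact.out
  rw [AddSubgroup.index, Module.natCard_eq_pow_finrank (K := ZMod p), Nat.card_zmod]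
  exact Nat.pow_le_pow_right hp.pos (finrank_quotient_primePowMultiples_le T hT hTA)

theorem primePowMultiples_le_comap (f : AddMonoid.End A) (n : ℕ) :
    primePowMultiples p A n ≤ (primePowMultiples p A n).comap (f : A →+ A) := by
  rintro _ ⟨b, rfl⟩
  exact ⟨f b, (map_nsmul f _ b).symm⟩

/-- The representation on `A / p A` induced by an action on `A`. -/
noncomputable def reductionHom (p : ℕ) (ρ : Q →* AddMonoid.End A) :
    Q →* Module.End (ZMod p) (A ⧸ primePowMultiples p A 1) where
  toFun q := AddMonoidHom.toZModLinearMap p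
    (QuotientAddGroup.map (primePowMultiples p A 1) (primePowMultiples p A 1)
      (ρ q : A →+ A) (primePowMultiples_le_comap (ρ q) 1))
  map_one' := by
    refine LinearMap.ext fun x ↦ ?_
    induction x using QuotientAddGroup.induction_on with
    | H a =>
      exact congrArg (QuotientAddGroup.mk (s := primePowMultiples p A 1))
        (by rw [map_one]; rfl : ρ 1 a = a)
  map_mul' q r := by
    refine LinearMap.ext fun x ↦ ?_
    induction x using QuotientAddGroup.induction_on with
    | H a =>
      exact congrArg (QuotientAddGroup.mk (s := primePowMultiples p A 1))
        (by rw [map_mul]; rfl : ρ (q * r) a = ρ q (ρ r a))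

theorem ker_reductionHom_le (ρ : Q →* AddMonoid.End A) :
    (reductionHom p ρ).ker ≤ congruenceKernel p ρ 1 := by
  intro q hq a
  have h1 : reductionHom p ρ q (QuotientAddGroup.mk a) = QuotientAddGroup.mk (ρ q a) := rfl
  rw [MonoidHom.mem_ker.1 hq, Module.End.one_apply] at h1
  rw [← QuotientAddGroup.eq_zero_iff]
  change QuotientAddGroup.mk (ρ q a - a) = _
  rw [QuotientAddGroup.mk_sub, ← h1, sub_self]

theorem IsPGroup.exists_closure_sup_congruenceKernel_eq_top [Fact p.Prime] [Finite Q]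
    (hQ : IsPGroup p Q) [Finite A] (ρ : Q →* AddMonoid.End A) {d : ℕ} (T : Finset A)
    (hT : T.card ≤ d) (hTA : AddSubgroup.closure (T : Set A) = ⊤) :
    ∃ S : Finset Q, S.card ≤ d ^ 2 / 4 ∧
      Subgroup.closure (S : Set Q) ⊔ congruenceKernel p ρ 1 = ⊤ := by
  obtain ⟨S, hS, hST⟩ := hQ.exists_closure_sup_ker_eq_top (reductionHom p ρ)
  exact ⟨S, hS.trans (Nat.div_le_div_right (Nat.pow_le_pow_left
    (finrank_quotient_primePowMultiples_le T hT hTA) 2)),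
    top_le_iff.1 (hST.ge.trans (sup_le_sup_left (ker_reductionHom_le ρ) _))⟩

theorem Subgroup.card_le_mul_card_of_injOn_cosets [Finite Q] {K₁ K₂ : Subgroup Q} (hle : K₂ ≤ K₁)
    {X : Type*} [Finite X] (f : Q → X)
    (hf : ∀ q ∈ K₁, ∀ r ∈ K₁, f q = f r → r⁻¹ * q ∈ K₂) :
    Nat.card K₁ ≤ Nat.card X * Nat.card K₂ := by
  have hinj : Function.Injective fun c : K₁ ⧸ K₂.subgroupOf K₁ ↦ f c.out := by
    intro c c' h
    have := (QuotientGroup.eq (s := K₂.subgroupOf K₁)).2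
      (Subgroup.mem_subgroupOf.2 (hf _ c.out.2 _ c'.out.2 h))
    rw [QuotientGroup.out_eq', QuotientGroup.out_eq'] at this
    exact this.symm
  have h1 := Nat.card_le_card_of_injective _ hinj
  rw [← Subgroup.card_mul_index (K₂.subgroupOf K₁), mul_comm,
    Nat.card_congr (Subgroup.subgroupOfEquivOfLe hle).toEquiv]
  exact Nat.mul_le_mul_right _ h1

theorem inv_mul_mem_congruenceKernel {ρ : Q →* AddMonoid.End A} {n : ℕ} {q r : Q}
    (h : ρ q - ρ r ∈ congruenceIdeal p A n) : r⁻¹ * q ∈ congruenceKernel p ρ n := by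
  have h2 : ρ (r⁻¹ * q) - 1 = ρ r⁻¹ * (ρ q - ρ r) := by
    rw [mul_sub, ← map_mul, ← map_mul]; simp
  rw [mem_congruenceKernel, h2]
  have h0 : ρ r⁻¹ ∈ congruenceIdeal p A 0 := fun x ↦ ⟨ρ r⁻¹ x, by simp⟩
  have h1 := mul_mem_congruenceIdeal h0 h
  rwa [Nat.add_zero] at h1

/-- Multiplication by p makes pA/p^2 A a quotient of A/pA. -/
theorem card_map_primePowMultiples_le [Fact p.Prime] [Finite A] {d : ℕ} (T : Finset A)
    (hT : T.card ≤ d) (hTA : AddSubgroup.closure (T : Set A) = ⊤) :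
    Nat.card ((primePowMultiples p A 1).map (QuotientAddGroup.mk' (primePowMultiples p A 2))) ≤
      p ^ d := by
  have h : (primePowMultiples p A 1).map (QuotientAddGroup.mk' (primePowMultiples p A 2)) =
      ((QuotientAddGroup.mk' (primePowMultiples p A 2)).comp
        (nsmulAddMonoidHom (α := A) (p ^ 1))).range := AddMonoidHom.map_range _ _
  rw [h, ← AddSubgroup.index_ker]
  refine le_trans (Nat.le_of_dvd (Nat.pos_of_ne_zero AddSubgroup.index_ne_zero_of_finite)
    (AddSubgroup.index_dvd_of_le ?_)) (index_primePowMultiples_le T hT hTA)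
  intro a ha
  exact (QuotientAddGroup.eq_zero_iff _).2 (by
    rw [pow_one]; exact nsmul_mem_primePowMultiples ha)

/-- The values of q - 1 on T modulo p^2 A lie in pA/p^2 A and separate the cosets of the second
kernel. -/
theorem card_congruenceKernel_le [Fact p.Prime] [Finite Q] [Finite A]
    (ρ : Q →* AddMonoid.End A) {d : ℕ} (T : Finset A)
    (hT : T.card ≤ d) (hTA : AddSubgroup.closure (T : Set A) = ⊤) :
    Nat.card (congruenceKernel p ρ 1) ≤ p ^ (d * d) * Nat.card (congruenceKernel p ρ 2) := by
  classical
  have hp : p.Prime := Fact.out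
  have hμ := card_map_primePowMultiples_le (p := p) T hT hTA
  set π := QuotientAddGroup.mk' (primePowMultiples p A 2)
  have hπ : ∀ a, π a = 0 ↔ a ∈ primePowMultiples p A 2 := fun a ↦ QuotientAddGroup.eq_zero_iff a
  clear_value π
  set I := (primePowMultiples p A 1).map π
  let f : Q → T → I := fun q t ↦
    if h : π ((ρ q - 1) t) ∈ I then ⟨π ((ρ q - 1) t), h⟩ else 0
  have hmem : ∀ q ∈ congruenceKernel p ρ 1, ∀ t : T, (f q t : _) = π ((ρ q - 1) t) := by
    intro q hq t
    have h : π ((ρ q - 1) t) ∈ I := ⟨_, hq t, rfl⟩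
    simp only [f, dif_pos h]
  refine (Subgroup.card_le_mul_card_of_injOn_cosets (K₂ := congruenceKernel p ρ 2)
    (fun q hq ↦ congruenceIdeal_anti one_le_two hq) f fun q hq r hr h ↦ ?_).trans
    (Nat.mul_le_mul_right _ ?_)
  · refine inv_mul_mem_congruenceKernel (mem_congruenceIdeal_of_closure hTA fun t ht ↦ ?_)
    have h1 := hmem q hq ⟨t, ht⟩
    rw [h, hmem r hr, eq_comm, ← sub_eq_zero, ← map_sub, hπ] at h1
    have h2 : (ρ q - 1) t - (ρ r - 1) t = (ρ q - ρ r) t := sub_sub_sub_cancel_right _ _ t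
    rwa [h2] at h1
  · rw [Nat.card_fun, Nat.card_eq_fintype_card (α := T), Fintype.card_coe]
    calc _ ≤ (p ^ d) ^ T.card := Nat.pow_le_pow_left hμ _
      _ = p ^ (d * T.card) := by rw [pow_mul]
      _ ≤ _ := Nat.pow_le_pow_right hp.pos (Nat.mul_le_mul_left _ hT)

theorem IsPGroup.exists_closure_eq_congruenceKernel [Fact p.Prime] [Finite Q]
    (hQ : IsPGroup p Q) [Finite A] {N : ℕ}
    (hN : ∀ a : A, p ^ N • a = 0) {n₀ : ℕ} (hn₀ : 0 < n₀) (hpn : 2 ≤ (p - 1) * n₀)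
    (ρ : Q →* AddMonoid.End A) (hρ : Function.Injective ρ) {d d' : ℕ} (T : Finset A)
    (hT : T.card ≤ d) (hTA : AddSubgroup.closure (T : Set A) = ⊤)
    (hd' : Nat.card (primePowSocle p A n₀) ≤ p ^ d') :
    ∃ S : Finset Q, S.card ≤ d * d' ∧
      Subgroup.closure (S : Set Q) = congruenceKernel p ρ n₀ := by
  classical
  obtain ⟨S, hS, hS'⟩ := (hQ.to_subgroup
    (congruenceKernel p ρ n₀)).exists_closure_eq_top_of_congruence hN hn₀ hpn (ρ.comp (congruenceKernel p ρ n₀).subtype)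
    (hρ.comp (congruenceKernel p ρ n₀).subtype_injective) (fun q ↦ q.2) T hT hTA hd'
  refine ⟨S.image (congruenceKernel p ρ n₀).subtype, Finset.card_image_le.trans hS, ?_⟩
  rw [Finset.coe_image, ← MonoidHom.map_closure, hS', ← MonoidHom.range_eq_map,
    Subgroup.range_subtype]

/-- The generator bound for `p`-groups of automorphisms of finite abelian `p`-groups. -/
theorem IsPGroup.exists_closure_eq_top_of_finite [Fact p.Prime] [Finite Q]
    (hQ : IsPGroup p Q) [Finite A] {N : ℕ} (hN : ∀ a : A, p ^ N • a = 0)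
    (ρ : Q →* AddMonoid.End A) (hρ : Function.Injective ρ) {d d' : ℕ} (T : Finset A)
    (hT : T.card ≤ d) (hTA : AddSubgroup.closure (T : Set A) = ⊤)
    (hd' : Nat.card (primePowSocle p A (if p = 2 then 2 else 1)) ≤ p ^ d') :
    ∃ S : Finset Q, S.card ≤ d * d' + d ^ 2 / 4 + (if p = 2 then d * d else 0) ∧
      Subgroup.closure (S : Set Q) = ⊤ := by
  classical
  have hp : p.Prime := Fact.out
  obtain ⟨S₁, hS₁, hT₁⟩ := hQ.exists_closure_sup_congruenceKernel_eq_top ρ T hT hTA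
  by_cases h2 : p = 2
  · rw [if_pos h2] at *
    obtain ⟨S₂, hS₂, hT₂⟩ := hQ.exists_closure_sup_eq (d * d)
      (fun q hq ↦ congruenceIdeal_anti one_le_two hq) (card_congruenceKernel_le ρ T hT hTA)
    obtain ⟨S₃, hS₃, hT₃⟩ := hQ.exists_closure_eq_congruenceKernel hN (n₀ := 2) two_pos
      (by omega) ρ hρ T hT hTA hd'
    refine ⟨S₁ ∪ (S₂ ∪ S₃), ?_, ?_⟩
    · have := Finset.card_union_le S₁ (S₂ ∪ S₃)
      have := Finset.card_union_le S₂ S₃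
      omega
    · rw [Finset.coe_union, Finset.coe_union, Subgroup.closure_union, Subgroup.closure_union, hT₃,
        hT₂, hT₁]
  · rw [if_neg h2] at *
    have := hp.two_le
    obtain ⟨S₃, hS₃, hT₃⟩ := hQ.exists_closure_eq_congruenceKernel hN (n₀ := 1) one_pos
      (by omega) ρ hρ T hT hTA hd'
    refine ⟨S₁ ∪ S₃, ?_, ?_⟩
    · have := Finset.card_union_le S₁ S₃
      omega
    · rw [Finset.coe_union, Subgroup.closure_union, hT₃, hT₁]

end FiniteCase

/-! ### Reduction to finite groups -/

section Faithful

variable {p : ℕ} {A : Type*} [AddCommGroup A]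

theorem exists_add_one_pow_eq {R : Type*} [Ring R] (θ : R) (n : ℕ) :
    ∃ w, (θ + 1) ^ n = 1 + n • θ + θ * (θ * w) := by
  induction n with
  | zero => exact ⟨0, by simp⟩
  | succ n ih =>
    obtain ⟨w, hw⟩ := ih
    refine ⟨n • 1 + w + w * θ, ?_⟩
    rw [pow_succ, hw]
    simp only [nsmul_eq_mul, Nat.cast_add, Nat.cast_one]
    have hc : θ * (n : R) = n * θ := (Nat.cast_comm n θ).symm
    noncomm_ring [hc]
    rw [← mul_assoc θ (n : R) θ, hc]
    noncomm_ring

/-- An automorphism of order `p` of an abelian `p`-group `A` which is trivial on the elements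
of order dividing `p ^ k` is trivial, provided that `p ^ k A` is divisible by `p`. -/
theorem eq_zero_of_add_one_pow_eq_one {k : ℕ} (hk : 2 ≤ k)
    (hdiv : ∀ a : A, ∃ b, p ^ k • a = p ^ (k + 1) • b) (hA : ∀ a : A, ∃ n, p ^ n • a = 0)
    {θ : AddMonoid.End A} (hθ : (θ + 1) ^ p = 1) (h : ∀ a, p ^ k • a = 0 → θ a = 0) : θ = 0 := by
  -- The relation (θ + 1)^p = 1 becomes pθ = -θ²w. As a ≡ p y modulo the p^k-torsion, θ a = pθ y =
  -- -θ(θ(w y)), and θ(w y) is killed by p^(b+2). Since k ≥ 2, this exponent is at most k + b and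
  -- the induction applies.
  obtain ⟨w, hw⟩ := exists_add_one_pow_eq θ p
  rw [hθ] at hw
  have key : ∀ b, ∀ a, p ^ (k + b) • a = 0 → θ a = 0 := by
    intro b
    induction b with
    | zero => simpa using h
    | succ b ih =>
      intro a ha
      obtain ⟨y, hy⟩ := hdiv a
      have h1 : θ a = p • θ y := by
        have := h (a - p • y) (by rw [smul_sub, hy, ← mul_smul, ← pow_succ, sub_self])
        rwa [map_sub, sub_eq_zero, map_nsmul] at this
      have h2 : p • θ y = -θ (θ (w y)) := by
        have := DFunLike.congr_fun hw y
        change y = y + (p • θ) y + θ (θ (w y)) at this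
        rw [add_assoc, left_eq_add] at this
        exact eq_neg_of_add_eq_zero_left this
      have h3 : p ^ (k + b + 2) • w y = 0 := by
        have : p ^ (k + b + 2) • y = 0 := by
          have e : p ^ (k + b + 2) • y = p ^ (b + 1) • p ^ (k + 1) • y := by
            rw [← mul_smul, ← pow_add]; congr 2; ring
          rw [e, ← hy, ← mul_smul, ← pow_add, add_comm (b + 1) k, ha]
        rw [← map_nsmul, this, map_zero]
      have h4 : p ^ (b + 2) • θ (w y) = 0 := by
        rw [← map_nsmul]
        refine h _ ?_
        rw [← mul_smul, ← pow_add, ← add_assoc, h3]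
      rw [h1, h2, neg_eq_zero]
      refine ih _ ?_
      obtain ⟨c, rfl⟩ := Nat.exists_eq_add_of_le hk
      rw [show 2 + c + b = c + (b + 2) by ring, pow_add, mul_smul, h4, smul_zero]
  ext a
  obtain ⟨n, hn⟩ := hA a
  exact key n a (by rw [pow_add, mul_smul, hn, smul_zero])

/-- The socles of p^n A decrease inside a finite group, so they stabilise; from a k where the order
is minimal, every socle element of p^k A lies in all p^n A. -/
theorem exists_primePowMultiples_divisible [Finite (nsmulAddMonoidHom (α := A) p).ker]
    (hA : ∀ a : A, ∃ n, p ^ n • a = 0) :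
    ∃ k, 2 ≤ k ∧ ∀ a : A, ∃ b, p ^ k • a = p ^ (k + 1) • b := by
  have hfin : ∀ n, Finite (primePowSocle p A n) := fun n ↦
    Finite.of_injective _ (AddSubgroup.inclusion_injective
      (inf_le_right : primePowSocle p A n ≤ (nsmulAddMonoidHom (α := A) p).ker))
  obtain ⟨k, hk, hmin⟩ : ∃ k, 2 ≤ k ∧ ∀ n, 2 ≤ n →
      Nat.card (primePowSocle p A k) ≤ Nat.card (primePowSocle p A n) := by
    classical
    have hex : ∃ c k, 2 ≤ k ∧ Nat.card (primePowSocle p A k) = c := ⟨_, 2, le_rfl, rfl⟩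
    obtain ⟨k, hk, hc⟩ := Nat.find_spec hex
    exact ⟨k, hk, fun n hn ↦ hc ▸ Nat.find_min' hex ⟨n, hn, rfl⟩⟩
  have hsoc : ∀ n, k ≤ n → primePowSocle p A k ≤ primePowMultiples p A n := by
    intro n hn
    have hle : primePowSocle p A n ≤ primePowSocle p A k :=
      inf_le_inf_right _ (primePowMultiples_anti hn)
    rw [← AddSubgroup.eq_of_le_of_card_ge hle (hmin n (hk.trans hn))]
    exact inf_le_left
  have key : ∀ n, ∀ x ∈ primePowMultiples p A k, p ^ n • x = 0 →
      x ∈ primePowMultiples p A (k + 1) := by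
    intro n
    induction n with
    | zero =>
      intro x _ h
      rw [pow_zero, one_smul] at h
      rw [h]; exact zero_mem _
    | succ n ih =>
      intro x hx h
      -- p^n x is in the socle, hence equals p^(k+1+n) z; then x - p^(k+1) z is killed by p^n.
      obtain ⟨z, hz⟩ := hsoc (k + 1 + n) (by omega)
        (mem_primePowSocle.2 ⟨nsmul_mem hx (p ^ n), by rw [← mul_smul, ← pow_succ', h]⟩)
      simp only [nsmulAddMonoidHom_apply] at hz
      have h1 : p ^ (k + 1) • z ∈ primePowMultiples p A (k + 1) := ⟨z, rfl⟩
      have h2 := ih (x - p ^ (k + 1) • z)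
        (sub_mem hx (primePowMultiples_anti k.le_succ h1)) (by
          rw [smul_sub, ← hz, ← mul_smul, ← pow_add, add_comm n, sub_self])
      simpa using add_mem h2 h1
  refine ⟨k, hk, fun a ↦ ?_⟩
  obtain ⟨n, hn⟩ := hA (p ^ k • a)
  obtain ⟨b, hb⟩ := key n (p ^ k • a) ⟨a, rfl⟩ hn
  exact ⟨b, hb.symm⟩

end Faithful

section Rank

variable {G : Type*}

theorem rank_le_of_pruferRank_le [Group G] {d : ℕ} (hd : pruferRank G ≤ d) (H : Subgroup G)
    [h : Group.FG H] : Group.rank H ≤ d := by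
  have h1 : ((Group.rank H : ℕ) : ℕ∞) ≤ pruferRank G :=
    le_iSup₂ (f := fun (H : Subgroup G) (h : Group.FG H) ↦ ((@Group.rank H _ h : ℕ) : ℕ∞)) H h
  exact_mod_cast h1.trans hd

theorem pruferRank_subgroup_le [Group G] (C : Subgroup G) : pruferRank C ≤ pruferRank G := by
  refine iSup₂_le fun H h ↦ ?_
  let e : H ≃* H.map C.subtype := H.equivMapOfInjective _ C.subtype_injective
  have hfg : Group.FG (H.map C.subtype) := Group.fg_of_surjective (f := e.toMonoidHom) e.surjective
  rw [Group.rank_congr e]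
  exact le_iSup₂ (f := fun (H : Subgroup G) (h : Group.FG H) ↦ ((@Group.rank H _ h : ℕ) : ℕ∞))
    (H.map C.subtype) hfg

variable [CommGroup G]

/-- The subgroup generated by F is abelian of exponent dividing m with at most d generators, so its
order divides a power of m with exponent at most d. -/
theorem card_finset_le_of_pruferRank_le {d : ℕ} (hd : pruferRank G ≤ d) {m : ℕ} (hm : 0 < m)
    (F : Finset G) (hF : ∀ x ∈ F, x ^ m = 1) : F.card ≤ m ^ d := by
  set H := Subgroup.closure (F : Set G)
  have hfg : Group.FG H := Group.closure_finset_fg F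
  have hle : H ≤ (powMonoidHom (α := G) m).ker := (Subgroup.closure_le _).2 hF
  have hdvd := card_dvd_exponent_pow_rank' H (n := m) fun g ↦ Subtype.ext (hle g.2)
  have hpos : 0 < m ^ Group.rank H := by positivity
  have hcard : Nat.card H ≤ m ^ d := (Nat.le_of_dvd hpos hdvd).trans
    (Nat.pow_le_pow_right hm (rank_le_of_pruferRank_le hd H))
  have hfin : Finite H := Nat.finite_of_card_ne_zero (ne_zero_of_dvd_ne_zero hpos.ne' hdvd)
  refine le_trans ?_ hcard
  rw [← Nat.card_eq_finsetCard]
  exact Nat.card_le_card_of_injective (fun x : F ↦ (⟨x, Subgroup.subset_closure x.2⟩ : H))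
    fun x y h ↦ Subtype.ext (congrArg (fun z : H ↦ (z : G)) h)

theorem finite_ker_pow_of_pruferRank_le {d : ℕ} (hd : pruferRank G ≤ d) {m : ℕ} (hm : 0 < m) :
    Finite (powMonoidHom (α := G) m).ker := by
  by_contra hinf
  rw [not_finite_iff_infinite] at hinf
  obtain ⟨F, hF⟩ := Infinite.exists_subset_card_eq (powMonoidHom (α := G) m).ker (m ^ d + 1)
  have := card_finset_le_of_pruferRank_le hd hm (F.map ⟨_, Subtype.val_injective⟩) (by
    intro x hx
    obtain ⟨y, -, rfl⟩ := Finset.mem_map.1 hx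
    exact y.2)
  rw [Finset.card_map, hF] at this
  omega

theorem card_ker_pow_le_of_pruferRank_le {d : ℕ} (hd : pruferRank G ≤ d) {m : ℕ} (hm : 0 < m) :
    Nat.card (powMonoidHom (α := G) m).ker ≤ m ^ d := by
  have := finite_ker_pow_of_pruferRank_le hd hm
  have := Fintype.ofFinite (powMonoidHom (α := G) m).ker
  have h := card_finset_le_of_pruferRank_le hd hm
    ((Finset.univ : Finset (powMonoidHom (α := G) m).ker).map ⟨_, Subtype.val_injective⟩) (by
    intro x hx
    obtain ⟨y, -, rfl⟩ := Finset.mem_map.1 hx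
    exact y.2)
  rwa [Finset.card_map, Finset.card_univ, ← Nat.card_eq_fintype_card] at h

/-- The action of the automorphisms of `G`, written additively. -/
def mulAutToEnd (G : Type*) [CommGroup G] : MulAut G →* AddMonoid.End (Additive G) where
  toFun α := MonoidHom.toAdditive α.toMonoidHom
  map_one' := rfl
  map_mul' _ _ := rfl

/-- The action of the automorphisms of `G` on the elements of order dividing `m`. -/
def mulAutToEndKer (G : Type*) [CommGroup G] (m : ℕ) :
    MulAut G →* AddMonoid.End (Additive (powMonoidHom (α := G) m).ker) where
  toFun α := MonoidHom.toAdditive <|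
    (α.toMonoidHom.comp (powMonoidHom (α := G) m).ker.subtype).codRestrict
    (powMonoidHom (α := G) m).ker fun x ↦ by
      have hx : (x : G) ^ m = 1 := x.2
      change (α (x : G)) ^ m = 1
      rw [← map_pow, hx, map_one]
  map_one' := rfl
  map_mul' _ _ := rfl

theorem mulAutToEndKer_faithful {p : ℕ} [Fact p.Prime] (hG : IsPGroup p G) {k : ℕ} (hk : 2 ≤ k)
    (hdiv : ∀ a : Additive G, ∃ b, p ^ k • a = p ^ (k + 1) • b)
    (P : Subgroup (MulAut G)) (hP : IsPGroup p P) :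
    Function.Injective ((mulAutToEndKer G (p ^ k)).comp P.subtype) := by
  rw [injective_iff_map_eq_one]
  intro q hq
  by_contra hne
  obtain ⟨s, hs⟩ := IsPGroup.iff_orderOf.1 hP q
  obtain ⟨s, rfl⟩ : ∃ t, s = t + 1 := Nat.exists_eq_succ_of_ne_zero (by
    rintro rfl
    exact hne (orderOf_eq_one_iff.1 (by simpa using hs)))
  -- A non-trivial kernel contains an element of order p, to which the relation (θ + 1)^p = 1
  -- applies.
  set r := q ^ p ^ s
  have hrp : r ^ p = 1 := by rw [← pow_mul, ← pow_succ, ← hs, pow_orderOf_eq_one]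
  have hr1 : r ≠ 1 := by
    refine pow_ne_one_of_lt_orderOf (pow_ne_zero _ (Fact.out : p.Prime).ne_zero) ?_
    rw [hs]
    exact Nat.pow_lt_pow_right (Fact.out : p.Prime).one_lt (Nat.lt_succ_self s)
  have hr : (mulAutToEndKer G (p ^ k)) r = 1 := by
    have : ((mulAutToEndKer G (p ^ k)).comp P.subtype) r = 1 := by rw [map_pow, hq, one_pow]
    exact this
  set θ : AddMonoid.End (Additive G) := mulAutToEnd G r - 1
  have hθ : θ = 0 := by
    refine eq_zero_of_add_one_pow_eq_one (p := p) hk hdiv (fun a ↦ hG a.toMul) ?_ fun a ha ↦ ?_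
    · rw [sub_add_cancel, ← map_pow]
      have : ((r : MulAut G)) ^ p = 1 := by rw [← Subgroup.coe_pow, hrp, Subgroup.coe_one]
      rw [this, map_one]
    · have h1 := DFunLike.congr_fun hr (Additive.ofMul ⟨a.toMul, ha⟩)
      have h2 : (r : MulAut G) a.toMul = a.toMul := congrArg (fun x ↦ (Additive.toMul x).1) h1
      exact sub_eq_zero.2 h2
  refine hr1 (Subtype.ext (MulEquiv.ext fun g ↦ ?_))
  exact DFunLike.congr_fun (sub_eq_zero.1 hθ) (Additive.ofMul g)

end Rank

/-! ### The generator bound -/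

section Main

theorem pow_mem_commPowSubgroup {p : ℕ} {G : Type*} [Group G] (g : G) :
    g ^ p ^ (if p = 2 then 2 else 1) ∈ commPowSubgroup p G := by
  refine (le_sup_right : powSubgroup _ G ≤ _) (Subgroup.subset_closure ⟨g, ?_⟩)
  split_ifs with h
  · simp [h]
  · simp

theorem exists_closure_eq_top_of_pruferRank {p : ℕ} [Fact p.Prime] {G : Type*} [CommGroup G]
    (hG : IsPGroup p G) {d d' : ℕ} (hd : pruferRank G ≤ d)
    (hd' : pruferRank (commPowSubgroup p G) ≤ d') (P : Subgroup (MulAut G)) (hP : IsPGroup p P) :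
    ∃ S : Finset P, S.card ≤ d * d' + d ^ 2 / 4 + (if p = 2 then d * d else 0) ∧
      Subgroup.closure (S : Set P) = ⊤ := by
  have hp : p.Prime := Fact.out
  have hfin : Finite (nsmulAddMonoidHom (α := Additive G) p).ker :=
    finite_ker_pow_of_pruferRank_le hd hp.pos
  obtain ⟨k, hk, hdiv⟩ := exists_primePowMultiples_divisible (p := p) (A := Additive G)
    (fun a ↦ hG a.toMul)
  have hinj := mulAutToEndKer_faithful hG hk hdiv P hP
  set M := (powMonoidHom (α := G) (p ^ k)).ker
  have hM : Finite M := finite_ker_pow_of_pruferRank_le hd (pow_pos hp.pos k)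
  have hA : Finite (Additive M) := hM
  have hE : Finite (AddMonoid.End (Additive M)) := DFunLike.finite _
  have hfinP : Finite P := Finite.of_injective _ hinj
  obtain ⟨T, hT, hTM⟩ := Group.rank_spec M
  refine hP.exists_closure_eq_top_of_finite (A := Additive M) (N := k)
    (fun a ↦ Subtype.ext a.toMul.2) _ hinj
    (T.map Additive.ofMul.toEmbedding)
    (by rw [Finset.card_map, hT]; exact rank_le_of_pruferRank_le hd M) ?_ ?_
  · have h := Subgroup.toAddSubgroup_closure (T : Set M)
    rw [hTM] at h
    have h2 : ((T.map Additive.ofMul.toEmbedding : Finset (Additive M)) : Set (Additive M)) =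
        Additive.toMul ⁻¹' (T : Set M) := by
      ext x
      simp
    rw [h2, ← h]
    rfl
  -- The socle of p^{n₀} M embeds in the p-torsion of P(G), whose rank is d'.
  · refine le_trans ?_ (card_ker_pow_le_of_pruferRank_le hd' hp.pos)
    have := finite_ker_pow_of_pruferRank_le hd' hp.pos
    refine Nat.card_le_card_of_injective (fun x ↦ ⟨⟨(x.1.toMul : G), ?_⟩, ?_⟩) ?_
    · obtain ⟨⟨b, hb⟩, -⟩ := x.2
      have h1 : (b.toMul : G) ^ p ^ (if p = 2 then 2 else 1) = (x.1.toMul : G) :=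
        congrArg (fun y : Additive M ↦ (y.toMul : G)) hb
      rw [← h1]
      exact pow_mem_commPowSubgroup _
    · exact Subtype.ext (congrArg (fun y : Additive M ↦ (y.toMul : G)) x.2.2)
    · intro x y h
      exact Subtype.ext (Subtype.ext (congrArg (fun z ↦ (z.1.1 : G)) h))

end Main

theorem theoremD {p : ℕ} (hp : p.Prime) {G : Type*} [CommGroup G] (hG : IsPGroup p G)
    (d d' : ℕ) (hd : pruferRank G = d) (hd' : pruferRank (commPowSubgroup p G) = d')
    (P : Subgroup (MulAut G)) (hP : IsPGroup p P) :
    (2 < p → ∃ S : Finset P, Subgroup.closure (S : Set P) = ⊤ ∧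
      (S.card : ℚ) ≤ (d : ℚ) * (d' : ℚ) + (d : ℚ) ^ 2 / 4) ∧
    (p = 2 → ∃ S : Finset P, Subgroup.closure (S : Set P) = ⊤ ∧
      (S.card : ℚ) ≤ (d : ℚ) * (d' : ℚ) + (3 * (d : ℚ) ^ 2 - (d : ℚ)) / 2) ∧
    ∃ _ : Group.FG P,
      (2 < p → (Group.rank P : ℚ) ≤ 5 * (d : ℚ) ^ 2 / 4) ∧
      (p = 2 → (Group.rank P : ℚ) ≤ (5 * (d : ℚ) ^ 2 - (d : ℚ)) / 2) := by
  have : Fact p.Prime := ⟨hp⟩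
  obtain ⟨S, hS, hSP⟩ := exists_closure_eq_top_of_pruferRank hG hd.le hd'.le P hP
  have hdd : (d' : ℚ) ≤ d := by
    have := pruferRank_subgroup_le (commPowSubgroup p G)
    rw [hd, hd'] at this
    exact_mod_cast this
  have hmul : (d : ℚ) * d' ≤ (d : ℚ) ^ 2 := by
    rw [pow_two]
    exact mul_le_mul_of_nonneg_left hdd (Nat.cast_nonneg d)
  have hodd : 2 < p → (S.card : ℚ) ≤ (d : ℚ) * (d' : ℚ) + (d : ℚ) ^ 2 / 4 := by
    intro h
    rw [if_neg (by omega), add_zero] at hS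
    have h1 : 4 * (d ^ 2 / 4) ≤ d ^ 2 := Nat.mul_div_le _ _
    have h2 : (S.card : ℚ) ≤ d * d' + (d ^ 2 / 4 : ℕ) := by exact_mod_cast hS
    have h3 : 4 * ((d ^ 2 / 4 : ℕ) : ℚ) ≤ (d : ℚ) ^ 2 := by exact_mod_cast h1
    linarith
  have heven : p = 2 →
      (S.card : ℚ) ≤ (d : ℚ) * (d' : ℚ) + (3 * (d : ℚ) ^ 2 - (d : ℚ)) / 2 := by
    intro h
    rw [if_pos h] at hS
    -- The rounding down matters: with the exact quotient the inequality fails at d = 1.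
    have h1 : 2 * (d ^ 2 / 4) + d ≤ d ^ 2 := by
      rcases Nat.lt_or_ge d 2 with h | h
      · interval_cases d <;> norm_num
      · have : 2 * d ≤ d ^ 2 := by nlinarith
        omega
    have h2 : (S.card : ℚ) ≤ d * d' + (d ^ 2 / 4 : ℕ) + d * d := by exact_mod_cast hS
    have h3 : 2 * ((d ^ 2 / 4 : ℕ) : ℚ) + d ≤ (d : ℚ) ^ 2 := by exact_mod_cast h1
    linarith
  have hFG : Group.FG P := Group.fg_iff'.2 ⟨S.card, S, rfl, hSP⟩
  have hrank : (Group.rank P : ℚ) ≤ S.card := by exact_mod_cast Group.rank_le hSP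
  refine ⟨fun h ↦ ⟨S, hSP, hodd h⟩, fun h ↦ ⟨S, hSP, heven h⟩, hFG, fun h ↦ ?_, fun h ↦ ?_⟩
  · have := hodd h
    linarith
  · have := heven h
    linarith
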